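/- **Setting.** Let $d,T\ge 1$ be integers and $L,\beta\ge 1$ reals; $\|\cdot\|_2$ is the Euclidean norm on $\mathbb R^d$, $\mathbb B$ and $\mathbb S$ are its closed unit ball and unit sphere, and $\|\cdot\|$ is any norm with $\|x\|_2\le\|x\|$ for all $x$ (for example $\|\cdot\|_2$ itself). In each round $t=1,\dots,T$ the environment picks a loss $\ell_t:\mathbb R^d\to\mathbb R$ that is convex, $L$-Lipschitz with respect to $\|\cdot\|_2$, differentiable and $\beta$-smooth, i.e. $\ell_t(y)\le \ell_t(x)+\langle\nabla\ell_t(x),y-x\rangle+\frac\beta2\|x-y\|_2^2$ for all $x,y$, and satisfies $\ell_t(0)=0$. The loss $\ell_t$ may be random and may depend on everything that happened before round $t$ (formally $\ell_t(x)$ is $\mathcal F_t$-measurable for every $x$, for a filtration $(\mathcal F_t)$). Put $$\delta=\min\{1,(dL)^{1/3}T^{-1/6}\},\qquad \eta=\sqrt{\frac{\delta^2}{4(dL)^2T}},\qquad L_{\mathcal V}=\frac{2dL+2\beta}{\delta}.$$ **Scaling algorithm.** Let $\mathcal A_{\mathcal V}$ be a deterministic one-dimensional online algorithm that plays $v_t$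 as a Borel function of the feedback $g_1,\dots,g_{t-1}$ and implements the scale learning interface on $l=(0,\delta^{-3}]$: for every sequence $g_1,\dots,g_T$ with $|g_t|\le L_{\mathcal V}$ its plays lie in $l$, and for every $\hat v\in l$ $$\sum_{t=1}^T(v_t-\hat v)g_t\le C_0(1+\log T+\log M)^k\,\bigl(1+|\hat v|L_{\mathcal V}\sqrt T\bigr),$$ where $C_0\in\mathbb R$, $k\in\mathbb N$ and $M\ge1$ is a real number. **Algorithm.** Start with $z_1=0$. In round $t$: get $v_t$ from $\mathcal A_{\mathcal V}$; draw $s_t$ uniformly from $\mathbb S$, independently of $\mathcal F_t$ ($s_t$ is $\mathcal F_{t+1}$-measurable); play $w_t=v_t(z_t+\delta s_t)$ and observe $\ell_t(w_t)$; set $\hat g_t=\frac{d}{v_t\delta}\ell_t(w_t)s_t$ and $\bar\ell_t(v)=v\langle z_t,\hat g_t\rangle+\beta\delta^2v^2$; send $\bar\ell_t'(v_t)$ to $\mathcal A_{\mathcal V}$ as its $t$-th feedback; let $z_{t+1}$ be the minimizer of $\eta\langle z,\hat g_t\rangle+\|z_t-z\|_2^2$ over $z\in\mathbb B$. **Theorem.**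 For every $C_0\in\mathbb R$ and $k\in\mathbb N$ there is a constant $C$, depending only on $C_0$ and $k$, such that for all $d,T,L,\beta,M$, all scaling algorithms, all environments, all norms $\|\cdot\|$ as above and all $u\in\mathbb R^d$, the regret $\mathcal R_T(u)=\sum_{t=1}^T(\ell_t(w_t)-\ell_t(u))$ is integrable and $$\mathbb E[\mathcal R_T(u)]\le C(1+\log T+\log M)^k\Bigl(1+\max\{\|u\|^2,\|u\|\}\,\beta(dLT)^{2/3}+\max\{\|u\|_2^2,\|u\|\}\,dL^2\beta\sqrt T\Bigr).$$ With $M=L$ this says that if the interface holds with an $\widetilde O$ that hides factors logarithmic in $T$ and $L$, then the regret bound holds with such an $\widetilde O$; the choice $M=\max\{1,L_{\mathcal V}\}$ covers interfaces whose bound is logarithmic in $T$ and $L_{\mathcal V}$. -/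

import Mathlib

open MeasureTheory ProbabilityTheory Set
open scoped Pointwise

noncomputable section

/-- `ℝ^d` with the Euclidean norm. -/
abbrev Vec (d : ℕ) : Type := EuclideanSpace ℝ (Fin d)

/-- The Euclidean unit sphere of `ℝ^d`. -/
abbrev USphere (d : ℕ) : Type := Metric.sphere (0 : Vec d) 1

/-- The uniform distribution `U(𝕊)`: the surface measure divided by its total mass
(a probability measure as soon as `1 ≤ d`). -/
def unifSphere (d : ℕ) : Measure (USphere d) :=
  ((volume : Measure (Vec d)).toSphere univ)⁻¹ • (volume : Measure (Vec d)).toSphere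

/-- `f` is `L`-Lipschitz on `ℝ^d` for the Euclidean norm. -/
def IsLip {d : ℕ} (L : ℝ) (f : Vec d → ℝ) : Prop :=
  ∀ x y, |f y - f x| ≤ L * ‖y - x‖

/-- `f` is `β`-smooth on `ℝ^d`: the gradient exists everywhere and
`f y ≤ f x + ⟪∇ f x, y - x⟫ + (β / 2) ‖x - y‖²`. -/
def IsSmooth {d : ℕ} (β : ℝ) (f : Vec d → ℝ) : Prop :=
  Differentiable ℝ f ∧
    ∀ x y, f y ≤ f x + inner ℝ (gradient f x) (y - x) + β / 2 * ‖x - y‖ ^ 2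

/-- A losses-to-predictions algorithm on the line: in round `t` (rounds are numbered from `0`)
it plays a number computed from the `t` feedback values received so far. -/
def ScaleAlg : Type := (t : ℕ) → (Fin t → ℝ) → ℝ

/-- The number that the algorithm plays in round `t` on the feedback sequence `g`. -/
def ScaleAlg.play (A : ScaleAlg) (g : ℕ → ℝ) (t : ℕ) : ℝ := A t (fun i => g i)

/-- The scale learning interface on the segment `l` over `T` rounds, for feedback bounded by `G`:
whatever the feedback values `g_t ∈ [-G, G]` are, the algorithm plays `v_t ∈ l`, and for all
`v ∈ l` its regret `∑ (v_t - v) g_t` is at most `Λ (1 + |v| G √T)`.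
The number `Λ` is the factor that `Õ` stands for. -/
structure ImplementsScale (A : ScaleAlg) (l : Set ℝ) (T : ℕ) (G Λ : ℝ) : Prop where
  measurable : ∀ t < T, Measurable (A t)
  mem : ∀ g : ℕ → ℝ, (∀ t < T, |g t| ≤ G) → ∀ t < T, A.play g t ∈ l
  regret : ∀ g : ℕ → ℝ, (∀ t < T, |g t| ≤ G) → ∀ v ∈ l,
    ∑ t ∈ Finset.range T, (A.play g t - v) * g t ≤ Λ * (1 + |v| * G * √(T : ℝ))

/-- The quadratic surrogate loss `v ↦ v ⟪z, ĝ⟫ + β δ² v²` for smooth losses. -/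
def surrogate {d : ℕ} (β δ : ℝ) (z ghat : Vec d) (v : ℝ) : ℝ :=
  v * inner ℝ z ghat + β * δ ^ 2 * v ^ 2

/-- The environment: in round `t` it picks a convex, `L`-Lipschitz and `β`-smooth loss with value
`0` at the origin. The loss may be random and may depend on everything that happened before
round `t`, which is the information recorded in `ℱ t`. -/
structure IsLossProcess {d : ℕ} {Ω : Type*} [mΩ : MeasurableSpace Ω] (ℱ : Filtration ℕ mΩ)
    (T : ℕ) (L β : ℝ) (loss : ℕ → Ω → Vec d → ℝ) : Prop where
  convex : ∀ t < T, ∀ ω, ConvexOn ℝ univ (loss t ω)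
  lipschitz : ∀ t < T, ∀ ω, IsLip L (loss t ω)
  smooth : ∀ t < T, ∀ ω, IsSmooth β (loss t ω)
  zero : ∀ t < T, ∀ ω, loss t ω 0 = 0
  adapted : ∀ t < T, ∀ x, Measurable[ℱ t] (fun ω => loss t ω x)

/-- The learner's random directions: `s t` is uniform on the sphere, is drawn independently of the
information `ℱ t` (which the loss of round `t` may depend on), and is part of `ℱ (t + 1)`. -/
structure IsSampling {d : ℕ} {Ω : Type*} [mΩ : MeasurableSpace Ω] (P : Measure Ω)
    (ℱ : Filtration ℕ mΩ) (T : ℕ) (s : ℕ → Ω → USphere d) : Prop where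
  measurable : ∀ t < T, Measurable[ℱ (t + 1)] (s t)
  law : ∀ t < T, P.map (s t) = unifSphere d
  indep : ∀ t < T, Indep (MeasurableSpace.comap (s t) inferInstance) (ℱ t) P

/-- `v, z, w, ghat` are the scales, directions, plays and gradient estimates of `T` rounds of the
black-box comparator-adaptive convex bandit algorithm for `β`-smooth losses, with scaling
algorithm `A`, parameters `δ, α`, domain `Z` and learning rate `η`. -/
structure IsBanditRun {d : ℕ} {Ω : Type*} (T : ℕ) (β δ α η : ℝ) (Z : Set (Vec d)) (A : ScaleAlg)
    (loss : ℕ → Ω → Vec d → ℝ) (s : ℕ → Ω → USphere d)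
    (v : ℕ → Ω → ℝ) (z w ghat : ℕ → Ω → Vec d) : Prop where
  init : ∀ ω, z 0 ω = 0
  scale : ∀ t < T, ∀ ω,
    v t ω = A.play (fun i => deriv (surrogate β δ (z i ω) (ghat i ω)) (v i ω)) t
  point : ∀ t < T, ∀ ω, w t ω = v t ω • (z t ω + δ • (s t ω : Vec d))
  estimate : ∀ t < T, ∀ ω,
    ghat t ω = ((d : ℝ) / (v t ω * δ) * loss t ω (w t ω)) • (s t ω : Vec d)
  update_mem : ∀ t < T, ∀ ω, z (t + 1) ω ∈ (1 - α) • Z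
  update_min : ∀ t < T, ∀ ω, IsMinOn
    (fun x => η * inner ℝ x (ghat t ω) + ‖z t ω - x‖ ^ 2) ((1 - α) • Z) (z (t + 1) ω)

/-- The regret `∑ (ℓ_t(w_t) - ℓ_t(u))` of `T` rounds against the comparator `u`. -/
def regret {d : ℕ} {Ω : Type*} (T : ℕ) (loss : ℕ → Ω → Vec d → ℝ) (w : ℕ → Ω → Vec d)
    (u : Vec d) (ω : Ω) : ℝ :=
  ∑ t ∈ Finset.range T, (loss t ω (w t ω) - loss t ω u)

/-- `δ = min {1, (dL)^{1/3} T^{-1/6}}`. -/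
def smoothDelta (d T : ℕ) (L : ℝ) : ℝ :=
  min 1 (((d : ℝ) * L) ^ (1 / 3 : ℝ) * (T : ℝ) ^ (-(1 / 6) : ℝ))

/-- `η = √(δ² / (4 (dL)² T))`. -/
def learningRate (d T : ℕ) (L δ : ℝ) : ℝ := √(δ ^ 2 / (4 * ((d : ℝ) * L) ^ 2 * (T : ℝ)))

/-- The bound `L_𝒱 = (2dL + 2β) / δ` for the feedback that the scaling algorithm is told to
expect: `2dL / δ` for the estimate and `2βδ² · δ⁻³` for the regularizer. -/
def feedbackBound (d : ℕ) (L β δ : ℝ) : ℝ := (2 * (d : ℝ) * L + 2 * β) / δ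

/-- The poly-logarithmic factor `C (1 + log T + log M)^k`. -/
def polylog (C : ℝ) (k T : ℕ) (M : ℝ) : ℝ := C * (1 + Real.log (T : ℝ) + Real.log M) ^ k

end

/-! One round is analysed conditionally on the past. With centre `x = v • z` and radius `r = v * δ`,
the expected loss at `x + r s` exceeds `f u` by at most the linear form of the one-point estimate at
`x - u`, plus `β r²` (`integral_sphere_sub_le`). The error `β r² = β δ² v²` is exactly the quadratic
term of the surrogate, so the scaling algorithm itself pays for the smoothing bias of large scales.

The one-round bound is obtained from an inequality in the radius. Let `h = u - x` and let `Φ ρ` be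
the spherical mean of `f (x + ρ s) ⟪h, s⟫`. Rotation invariance gives a divergence identity on the
sphere, which turns `(d - 1) Φ + ρ Φ'` into `ρ` times the mean of `⟪∇f (x + ρ s), h⟫`. Convexity
bounds the latter by the mean of `f (u + ρ s) - f (x + ρ s)`; smoothness at `u` and Jensen at `x`
bound this by a constant `K`. Integrating from `0` to `r` gives `d Φ r / r ≤ K`.

Along each path, write `u = a • y` with `‖y‖ ≤ 1`. Convexity of the surrogate splits the linearized
regret into `a` times the regret of projected gradient descent against `y`, the regret of the
scaling algorithm against `a`, and `T β δ² a²`. The estimates are bounded independently of the scale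
because `ℓ 0 = 0`.

It remains to treat comparators outside the scale segment. The case `u = 0` is the limit `a → 0`. If
`‖u‖ > δ⁻³`, comparing with `0` costs only `T L ‖u‖`, and the choice of `δ` makes `√T ≤ ‖u‖ d L`, so
this cost is at most `‖u‖² d L² √T`. -/

/-! ### Rotation invariance of the uniform measure on the sphere. -/

theorem isProbabilityMeasure_unifSphere {d : ℕ} (hd : 1 ≤ d) :
    IsProbabilityMeasure (unifSphere d) := by
  have : Nonempty (Fin d) := ⟨⟨0, hd⟩⟩
  refine ⟨?_⟩
  rw [unifSphere, Measure.smul_apply, smul_eq_mul]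
  refine ENNReal.inv_mul_cancel ?_ (measure_ne_top _ _)
  rw [Ne, Measure.measure_univ_eq_zero]
  exact Measure.toSphere_ne_zero _

/-- The surface measure of a set is a multiple of the volume of the cone over it. Linear isometries
carry cones to cones and preserve volume. -/
theorem map_coe_toSphere_map_isometry {d : ℕ} (e : Vec d ≃ₗᵢ[ℝ] Vec d) :
    (((volume : Measure (Vec d)).toSphere.map ((↑) : USphere d → Vec d)).map e) =
      (volume : Measure (Vec d)).toSphere.map ((↑) : USphere d → Vec d) := by
  have hval : Measurable ((↑) : USphere d → Vec d) := measurable_subtype_coe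
  have he : Measurable e := e.continuous.measurable
  have key : ∀ S : Set (Vec d), MeasurableSet S →
      (volume : Measure (Vec d)).toSphere.map ((↑) : USphere d → Vec d) S =
        Module.finrank ℝ (Vec d) * volume (Ioo (0 : ℝ) 1 • (S ∩ Metric.sphere 0 1)) := by
    intro S hS
    rw [Measure.map_apply hval hS, Measure.toSphere_apply' _ (hval hS),
      Subtype.image_preimage_coe, inter_comm]
  ext S hS
  rw [Measure.map_apply he hS, key _ (he hS), key _ hS]
  congr 1
  have hset : Ioo (0 : ℝ) 1 • (e ⁻¹' S ∩ Metric.sphere 0 1) =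
      e ⁻¹' (Ioo (0 : ℝ) 1 • (S ∩ Metric.sphere 0 1)) := by
    ext x
    simp only [mem_smul, mem_preimage, mem_inter_iff, mem_sphere_zero_iff_norm]
    constructor
    · rintro ⟨r, hr, y, ⟨hy, hy1⟩, rfl⟩
      exact ⟨r, hr, e y, ⟨hy, by simpa using hy1⟩, by simp⟩
    · rintro ⟨r, hr, y, ⟨hy, hy1⟩, h⟩
      refine ⟨r, hr, e.symm y, ⟨by simpa using hy, by simpa using hy1⟩, ?_⟩
      apply e.injective
      simpa using h
  rw [hset]
  exact (e.measurePreserving).measure_preimage_equiv (f := e.toMeasurableEquiv) _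

theorem integral_unifSphere_comp_isometry {d : ℕ} (e : Vec d ≃ₗᵢ[ℝ] Vec d) (g : Vec d → ℝ) :
    ∫ s : USphere d, g (e s) ∂unifSphere d = ∫ s : USphere d, g s ∂unifSphere d := by
  have hval : MeasurableEmbedding ((↑) : USphere d → Vec d) :=
    MeasurableEmbedding.subtype_coe Metric.isClosed_sphere.measurableSet
  have he : MeasurableEmbedding e := e.toMeasurableEquiv.measurableEmbedding
  rw [unifSphere, integral_smul_measure, integral_smul_measure]
  congr 1
  rw [← hval.integral_map (fun y => g (e y)), ← he.integral_map g, map_coe_toSphere_map_isometry e,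
    hval.integral_map g]

theorem integral_unifSphere_inner {d : ℕ} (h : Vec d) :
    ∫ s : USphere d, inner ℝ h (s : Vec d) ∂unifSphere d = 0 := by
  have := integral_unifSphere_comp_isometry (LinearIsometryEquiv.neg ℝ) (fun y : Vec d => inner ℝ h y)
  simp only [LinearIsometryEquiv.coe_neg, inner_neg_right, integral_neg] at this
  linarith

/-! ### A divergence identity on the sphere. -/

/-- The rotation by the angle `θ` in the plane spanned by the orthonormal vectors `a` and `b`. -/
noncomputable def planeRotation {d : ℕ} (a b : Vec d) (θ : ℝ) : Vec d →ₗ[ℝ] Vec d :=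
  LinearMap.id
    + ((Real.cos θ - 1) • innerₗ (Vec d) a - Real.sin θ • innerₗ (Vec d) b).smulRight a
    + ((Real.cos θ - 1) • innerₗ (Vec d) b + Real.sin θ • innerₗ (Vec d) a).smulRight b

theorem planeRotation_apply {d : ℕ} (a b : Vec d) (θ : ℝ) (x : Vec d) :
    planeRotation a b θ x = x
      + ((Real.cos θ - 1) * inner ℝ a x - Real.sin θ * inner ℝ b x) • a
      + ((Real.cos θ - 1) * inner ℝ b x + Real.sin θ * inner ℝ a x) • b := by
  simp [planeRotation]

theorem norm_planeRotation {d : ℕ} {a b : Vec d} (ha : ‖a‖ = 1) (hb : ‖b‖ = 1)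
    (hab : inner ℝ a b = (0 : ℝ)) (θ : ℝ) (x : Vec d) : ‖planeRotation a b θ x‖ = ‖x‖ := by
  have hba : inner ℝ b a = (0 : ℝ) := by rw [real_inner_comm, hab]
  have haa : inner ℝ a a = (1 : ℝ) := by rw [real_inner_self_eq_norm_sq, ha, one_pow]
  have hbb : inner ℝ b b = (1 : ℝ) := by rw [real_inner_self_eq_norm_sq, hb, one_pow]
  rw [← sq_eq_sq₀ (norm_nonneg _) (norm_nonneg _), ← real_inner_self_eq_norm_sq,
    ← real_inner_self_eq_norm_sq, planeRotation_apply]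
  simp only [inner_add_left, inner_add_right, real_inner_smul_left, real_inner_smul_right, hab, hba,
    haa, hbb, real_inner_comm a x, real_inner_comm b x]
  linear_combination ((inner ℝ a x) ^ 2 + (inner ℝ b x) ^ 2) * Real.sin_sq_add_cos_sq θ

theorem hasDerivAt_planeRotation {d : ℕ} (a b x : Vec d) (θ : ℝ) :
    HasDerivAt (fun θ => planeRotation a b θ x)
      ((-Real.sin θ * inner ℝ a x - Real.cos θ * inner ℝ b x) • a
        + (-Real.sin θ * inner ℝ b x + Real.cos θ * inner ℝ a x) • b) θ := by
  simp only [planeRotation_apply]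
  have h1 := (Real.hasDerivAt_cos θ).sub_const 1
  have h2 := Real.hasDerivAt_sin θ
  have := ((((h1.mul_const (inner ℝ a x)).sub (h2.mul_const (inner ℝ b x))).smul_const a).const_add
    x).add (((h1.mul_const (inner ℝ b x)).add (h2.mul_const (inner ℝ a x))).smul_const b)
  exact this

/-- The mean of `g` over the rotated sphere does not depend on the angle. Its derivative at angle
`0`, taken under the integral, is therefore zero. A bound for the derivative on the sphere suffices
for domination, since rotations preserve the sphere. -/
theorem integral_unifSphere_fderiv_rotation {d : ℕ} (hd : 1 ≤ d) {a b : Vec d} (ha : ‖a‖ = 1)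
    (hb : ‖b‖ = 1) (hab : inner ℝ a b = (0 : ℝ)) {g : Vec d → ℝ} (hg : Differentiable ℝ g) {C : ℝ}
    (hC : ∀ y, ‖y‖ = 1 → ‖fderiv ℝ g y‖ ≤ C) :
    ∫ s : USphere d, fderiv ℝ g s ((inner ℝ a (s : Vec d)) • b - (inner ℝ b (s : Vec d)) • a)
      ∂unifSphere d = 0 := by
  have := isProbabilityMeasure_unifSphere hd
  let R : ℝ → (Vec d ≃ₗᵢ[ℝ] Vec d) := fun θ =>
    LinearIsometry.toLinearIsometryEquiv
      ⟨planeRotation a b θ, norm_planeRotation ha hb hab θ⟩ rfl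
  have hR : ∀ θ x, R θ x = planeRotation a b θ x := fun θ x => rfl
  let V : ℝ → Vec d → Vec d := fun θ x =>
    (-Real.sin θ * inner ℝ a x - Real.cos θ * inner ℝ b x) • a
        + (-Real.sin θ * inner ℝ b x + Real.cos θ * inner ℝ a x) • b
  have hder := (hasDerivAt_integral_of_dominated_loc_of_deriv_le (μ := unifSphere d)
    (F := fun θ (s : USphere d) => g (R θ s))
    (F' := fun θ (s : USphere d) => fderiv ℝ g (R θ s) (V θ s)) (x₀ := (0 : ℝ))
    (bound := fun _ => C * 4) (s := univ) Filter.univ_mem ?_ ?_ ?_ ?_ ?_ ?_).2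
  · have hconst : (fun θ => ∫ s : USphere d, g (R θ s) ∂unifSphere d) =
        fun _ => ∫ s : USphere d, g s ∂unifSphere d := by
      funext θ
      exact integral_unifSphere_comp_isometry (R θ) g
    rw [hconst] at hder
    have h0 := hder.unique (hasDerivAt_const _ _)
    rw [← h0]
    congr 1
    funext s
    have h1 : R 0 s = (s : Vec d) := by simp [hR, planeRotation_apply]
    have h2 : V 0 s = (inner ℝ a (s : Vec d)) • b - (inner ℝ b (s : Vec d)) • a := by
      simp only [V, Real.sin_zero, Real.cos_zero]
      module
    rw [h1, h2]
  · refine Filter.Eventually.of_forall fun θ => ?_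
    exact (hg.continuous.comp ((R θ).continuous.comp continuous_subtype_val)).aestronglyMeasurable
  · exact (hg.continuous.comp ((R 0).continuous.comp
      continuous_subtype_val)).integrable_of_hasCompactSupport (HasCompactSupport.of_compactSpace _)
  · refine Measurable.aestronglyMeasurable ?_
    have h1 : Measurable (fun s : USphere d => fderiv ℝ g (R 0 s)) :=
      (measurable_fderiv ℝ g).comp ((R 0).continuous.measurable.comp measurable_subtype_coe)
    have h2 : Measurable (fun s : USphere d => V 0 s) := by
      have : Continuous (fun s : USphere d => V 0 s) := by
        simp only [V]
        fun_prop
      exact this.measurable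
    exact (isBoundedBilinearMap_apply (𝕜 := ℝ) (E := Vec d) (F := ℝ)).continuous.measurable.comp
      (h1.prodMk h2)
  · refine Filter.Eventually.of_forall fun s θ _ => ?_
    have hs : ‖(s : Vec d)‖ = 1 := by simp
    have hRs : ‖R θ s‖ = 1 := by rw [(R θ).norm_map, hs]
    have has : |inner ℝ a (s : Vec d)| ≤ 1 := by
      have := abs_real_inner_le_norm a (s : Vec d); rwa [ha, hs, mul_one] at this
    have hbs : |inner ℝ b (s : Vec d)| ≤ 1 := by
      have := abs_real_inner_le_norm b (s : Vec d); rwa [hb, hs, mul_one] at this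
    have hsin := Real.abs_sin_le_one θ
    have hcos := Real.abs_cos_le_one θ
    have p : ∀ x y : ℝ, |x| ≤ 1 → |y| ≤ 1 → |x * y| ≤ 1 := fun x y hx hy => by
      rw [abs_mul]; exact mul_le_one₀ hx (abs_nonneg _) hy
    have hV : ‖V θ s‖ ≤ 4 := by
      have h1 : ‖(-Real.sin θ * inner ℝ a (s : Vec d) - Real.cos θ * inner ℝ b (s : Vec d)) • a‖
          ≤ 2 := by
        rw [norm_smul, ha, mul_one, Real.norm_eq_abs]
        refine (abs_sub _ _).trans ?_
        linarith [p (-Real.sin θ) _ (by rwa [abs_neg]) has, p _ _ hcos hbs]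
      have h2 : ‖(-Real.sin θ * inner ℝ b (s : Vec d) + Real.cos θ * inner ℝ a (s : Vec d)) • b‖
          ≤ 2 := by
        rw [norm_smul, hb, mul_one, Real.norm_eq_abs]
        refine (abs_add_le _ _).trans ?_
        linarith [p (-Real.sin θ) _ (by rwa [abs_neg]) hbs, p _ _ hcos has]
      refine (norm_add_le _ _).trans ?_
      linarith
    refine ((fderiv ℝ g (R θ s)).le_opNorm _).trans ?_
    have hC0 := hC _ hRs
    have : 0 ≤ C := (norm_nonneg _).trans hC0
    gcongr
  · exact integrable_const _
  · refine Filter.Eventually.of_forall fun s θ _ => ?_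
    exact (hg (R θ s)).hasFDerivAt.comp_hasDerivAt θ (hasDerivAt_planeRotation a b s θ)

theorem inner_single_one_left {d : ℕ} (i : Fin d) (y : Vec d) :
    inner ℝ (EuclideanSpace.single i (1 : ℝ) : Vec d) y = y i := by
  rw [EuclideanSpace.inner_single_left]
  simp

theorem integrable_unifSphere_of_continuous {d : ℕ} (hd : 1 ≤ d) {g : USphere d → ℝ}
    (hg : Continuous g) : Integrable g (unifSphere d) := by
  have := isProbabilityMeasure_unifSphere hd
  exact hg.integrable_of_hasCompactSupport (HasCompactSupport.of_compactSpace _)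

theorem measurable_fderiv_apply_sphere {d : ℕ} (F : Vec d → ℝ) {V : USphere d → Vec d}
    (hV : Continuous V) : Measurable fun s : USphere d => fderiv ℝ F s (V s) :=
  (isBoundedBilinearMap_apply (𝕜 := ℝ) (E := Vec d) (F := ℝ)).continuous.measurable.comp
    (((measurable_fderiv ℝ F).comp measurable_subtype_coe).prodMk hV.measurable)

theorem integrable_fderiv_apply_sphere {d : ℕ} (hd : 1 ≤ d) {F : Vec d → ℝ} {C : ℝ}
    (hC : ∀ y, ‖fderiv ℝ F y‖ ≤ C) {V : USphere d → Vec d} (hV : Continuous V) :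
    Integrable (fun s : USphere d => fderiv ℝ F s (V s)) (unifSphere d) := by
  have hb := integrable_unifSphere_of_continuous hd (g := fun s => C * ‖V s‖) (by fun_prop)
  refine hb.mono' (measurable_fderiv_apply_sphere F hV).aestronglyMeasurable
    (Filter.Eventually.of_forall fun s => ?_)
  exact ((fderiv ℝ F s).le_opNorm _).trans (by gcongr; exact hC _)

/-- Integration by parts: differentiate `F y * y j` along the rotation in the plane of the
coordinates `i` and `j`, and sum over `j`. The radial derivative appears because the rotation fields
see only the tangential part of the gradient. -/
theorem sphere_divergence_coordinate {d : ℕ} (hd : 1 ≤ d) {F : Vec d → ℝ}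
    (hF : Differentiable ℝ F) {C : ℝ} (hC : ∀ y, ‖fderiv ℝ F y‖ ≤ C) (i : Fin d) :
    ∫ s : USphere d, ((((d : ℝ) - 1) * F s + fderiv ℝ F s s) * (s : Vec d) i
      - fderiv ℝ F s (EuclideanSpace.single i 1)) ∂unifSphere d = 0 := by
  have := isProbabilityMeasure_unifSphere hd
  have hFc := hF.continuous
  let e : Fin d → Vec d := fun i => EuclideanSpace.single i 1
  let I : Fin d → USphere d → ℝ := fun j s =>
    fderiv ℝ F s ((s : Vec d) i • e j - (s : Vec d) j • e i) * (s : Vec d) j + F s * (s : Vec d) i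
  have hcont : ∀ j, Continuous fun s : USphere d => (s : Vec d) j := fun j => by fun_prop
  have hFs : Integrable (fun s : USphere d => F s * (s : Vec d) i) (unifSphere d) :=
    integrable_unifSphere_of_continuous hd
      ((hFc.comp continuous_subtype_val).mul (hcont i))
  have hI : ∀ j, Integrable (I j) (unifSphere d) := by
    intro j
    refine Integrable.add ?_ hFs
    have := integrable_fderiv_apply_sphere hd hC
      (V := fun s => (s : Vec d) j • ((s : Vec d) i • e j - (s : Vec d) j • e i)) (by fun_prop)
    refine this.congr (Filter.Eventually.of_forall fun s => ?_)
    simp only [map_smul, smul_eq_mul]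
    ring
  have hIj : ∀ j, j ≠ i → ∫ s, I j s ∂unifSphere d = 0 := by
    intro j hj
    have hcoord : ∀ y : Vec d, inner ℝ (e j) y = y j := fun y => inner_single_one_left _ y
    have hcoord' : ∀ y : Vec d, inner ℝ (e i) y = y i := fun y => inner_single_one_left _ y
    let g : Vec d → ℝ := fun y => F y * inner ℝ (e j) y
    have hg : ∀ y, HasFDerivAt g (F y • (innerSL ℝ (e j)) + (inner ℝ (e j) y : ℝ) • fderiv ℝ F y) y :=
      fun y => (hF y).hasFDerivAt.mul (innerSL ℝ (e j)).hasFDerivAt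
    obtain ⟨K, hK⟩ := (isCompact_sphere (0 : Vec d) 1).exists_bound_of_continuousOn
      hFc.continuousOn
    have := integral_unifSphere_fderiv_rotation hd (a := e i) (b := e j) (g := g)
      (by simp [e]) (by simp [e]) (by rw [hcoord']; simp [e, hj.symm])
      (fun y => (hg y).differentiableAt) (C := K * 1 + 1 * C) (fun y hy => by
        rw [(hg y).fderiv]
        refine (norm_add_le _ _).trans ?_
        rw [norm_smul, norm_smul]
        have h1 := hK y (by simpa using hy)
        have h2 : ‖inner ℝ (e j) y‖ ≤ (1 : ℝ) := by
          refine (norm_inner_le_norm _ _).trans ?_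
          simp [hy, e]
        have h3 : ‖innerSL ℝ (e j)‖ ≤ 1 := by rw [innerSL_apply_norm]; simp [e]
        have h4 := hC y
        have : 0 ≤ K := (norm_nonneg _).trans h1
        gcongr)
    rw [← this]
    congr 1
    funext s
    rw [(hg s).fderiv]
    simp only [hcoord, hcoord', I, add_apply, smul_apply,
      innerSL_apply_apply, smul_eq_mul]
    have : ((s : Vec d) i • e j - (s : Vec d) j • e i) j = (s : Vec d) i := by
      simp [e, hj]
    rw [this]
    ring
  -- Only `j = i` survives. There the rotation field vanishes and `I i s` is `F s * s i`, which
  -- lowers the factor `d` to `d - 1`.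
  have hsum : ∫ s, ∑ j, I j s ∂unifSphere d = ∫ s : USphere d, F s * (s : Vec d) i ∂unifSphere d := by
    rw [integral_finsetSum _ (fun j _ => hI j), Finset.sum_eq_single i (fun j _ hj => hIj j hj)
      (by simp)]
    congr 1
    funext s
    simp [I]
  rw [← sub_eq_zero, ← integral_sub (integrable_finsetSum _ (fun j _ => hI j)) hFs] at hsum
  rw [← hsum]
  congr 1
  funext s
  have hs : ‖(s : Vec d)‖ = 1 := by simp
  have h1 : ∑ j, (s : Vec d) j ^ 2 = 1 := by
    have := EuclideanSpace.norm_sq_eq (s : Vec d)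
    simpa [hs] using this.symm
  have h2 : ∑ j, (s : Vec d) j • e j = (s : Vec d) := by
    ext k
    simp [e, Finset.sum_apply, Pi.single_apply]
  have h3 : fderiv ℝ F s s = ∑ j, (s : Vec d) j * fderiv ℝ F s (e j) := by
    conv_lhs => rw [← h2]
    rw [← h2]
    simp only [map_sum, map_smul, smul_eq_mul]
    simp only [h2]
  have h4 : ∑ j, I j s = (s : Vec d) i * ∑ j, (s : Vec d) j * fderiv ℝ F s (e j)
      - (∑ j, (s : Vec d) j ^ 2) * fderiv ℝ F s (e i) + d * (F s * (s : Vec d) i) := by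
    simp only [I, Finset.sum_add_distrib, map_sub, map_smul, smul_eq_mul, sub_mul,
      Finset.sum_sub_distrib, Finset.sum_const, Finset.card_univ, Fintype.card_fin, nsmul_eq_mul]
    rw [Finset.mul_sum, Finset.sum_mul]
    congr 2
    · exact Finset.sum_congr rfl fun j _ => by ring
    · exact Finset.sum_congr rfl fun j _ => by ring
  rw [h4, ← h3, h1]
  simp only [e]
  ring

theorem sphere_divergence {d : ℕ} (hd : 1 ≤ d) {F : Vec d → ℝ} (hF : Differentiable ℝ F) {C : ℝ}
    (hC : ∀ y, ‖fderiv ℝ F y‖ ≤ C) (h : Vec d) :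
    ∫ s : USphere d, (((d : ℝ) - 1) * F s + fderiv ℝ F s s) * inner ℝ h (s : Vec d) ∂unifSphere d
      = ∫ s : USphere d, fderiv ℝ F s h ∂unifSphere d := by
  have := isProbabilityMeasure_unifSphere hd
  have hFc := hF.continuous
  have hi1 : ∀ k : Vec d, Integrable (fun s : USphere d =>
      (((d : ℝ) - 1) * F s + fderiv ℝ F s s) * inner ℝ k (s : Vec d)) (unifSphere d) := by
    intro k
    have a1 := integrable_unifSphere_of_continuous hd
      (g := fun s : USphere d => ((d : ℝ) - 1) * F s * inner ℝ k (s : Vec d)) (by fun_prop)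
    have a2 := integrable_fderiv_apply_sphere hd hC
      (V := fun s => (inner ℝ k (s : Vec d) : ℝ) • (s : Vec d)) (by fun_prop)
    refine (a1.add a2).congr (Filter.Eventually.of_forall fun s => ?_)
    simp only [Pi.add_apply, map_smul, smul_eq_mul]
    ring
  have hi2 : ∀ k : Vec d, Integrable (fun s : USphere d => fderiv ℝ F s k) (unifSphere d) :=
    fun k => integrable_fderiv_apply_sphere hd hC continuous_const
  rw [← sub_eq_zero, ← integral_sub (hi1 h) (hi2 h)]
  have hh : ∑ i, h i • (EuclideanSpace.single i (1 : ℝ) : Vec d) = h := by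
    ext k
    simp [Finset.sum_apply, Pi.single_apply]
  have key : ∀ s : USphere d, (((d : ℝ) - 1) * F s + fderiv ℝ F s s) * inner ℝ h (s : Vec d)
      - fderiv ℝ F s h = ∑ i, h i * ((((d : ℝ) - 1) * F s + fderiv ℝ F s s) * (s : Vec d) i
      - fderiv ℝ F s (EuclideanSpace.single i 1)) := by
    intro s
    have e1 : inner ℝ h (s : Vec d) = ∑ i, h i * (s : Vec d) i := by
      simp [PiLp.inner_apply, mul_comm]
    have e2 : fderiv ℝ F s h = ∑ i, h i * fderiv ℝ F s (EuclideanSpace.single i 1) := by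
      conv_lhs => rw [← hh]
      simp only [map_sum, map_smul, smul_eq_mul]
    rw [e1, e2, Finset.mul_sum, ← Finset.sum_sub_distrib]
    exact Finset.sum_congr rfl fun i _ => by ring
  simp_rw [key]
  rw [integral_finsetSum]
  · refine Finset.sum_eq_zero fun i _ => ?_
    rw [integral_const_mul, sphere_divergence_coordinate hd hF hC i, mul_zero]
  · intro i _
    refine Integrable.const_mul (Integrable.sub ?_ (hi2 _)) _
    simpa only [inner_single_one_left] using hi1 (EuclideanSpace.single i 1)

/-! ### Spherical means of convex and smooth functions, and the one-point estimate. -/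

theorem IsLip.continuous {d : ℕ} {L : ℝ} {f : Vec d → ℝ} (hf : IsLip L f) : Continuous f := by
  have : LipschitzWith L.toNNReal f := by
    refine LipschitzWith.of_dist_le_mul fun x y => ?_
    rw [Real.dist_eq, dist_eq_norm]
    refine (hf y x).trans ?_
    gcongr
    exact Real.le_coe_toNNReal L
  exact this.continuous

theorem IsLip.norm_fderiv_le {d : ℕ} {L : ℝ} (hL : 0 ≤ L) {f : Vec d → ℝ} (hf : IsLip L f)
    (x : Vec d) : ‖fderiv ℝ f x‖ ≤ L :=
  norm_fderiv_le_of_lip' ℝ hL (Filter.Eventually.of_forall fun y => hf x y)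

theorem ConvexOn.fderiv_sub_le {d : ℕ} {f : Vec d → ℝ} (hc : ConvexOn ℝ univ f)
    (hf : Differentiable ℝ f) (x y : Vec d) : fderiv ℝ f x (y - x) ≤ f y - f x := by
  have hline : HasDerivAt (fun t : ℝ => f (x + t • (y - x))) (fderiv ℝ f x (y - x)) 0 := by
    have h1 : HasDerivAt (fun t : ℝ => x + t • (y - x)) (y - x) 0 := by
      simpa using ((hasDerivAt_id (0 : ℝ)).smul_const (y - x)).const_add x
    have h2 : HasFDerivAt f (fderiv ℝ f x) (x + (0 : ℝ) • (y - x)) := by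
      simpa using (hf x).hasFDerivAt
    exact h2.comp_hasDerivAt 0 h1
  have hconv : ConvexOn ℝ univ (fun t : ℝ => f (x + t • (y - x))) := by
    have := hc.comp_affineMap (AffineMap.lineMap x y : ℝ →ᵃ[ℝ] Vec d)
    refine (this.congr fun t _ => ?_)
    simp [AffineMap.lineMap_apply, add_comm]
  have := hconv.le_slope_of_hasDerivAt (mem_univ _) (mem_univ _) zero_lt_one hline
  simpa [slope_def_field] using this

/-- The linear term of the quadratic upper bound averages to zero by symmetry of the sphere. -/
theorem IsSmooth.integral_sphere_le {d : ℕ} (hd : 1 ≤ d) {β : ℝ} {f : Vec d → ℝ}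
    (hf : IsSmooth β f) (x : Vec d) (r : ℝ) :
    ∫ s : USphere d, f (x + r • (s : Vec d)) ∂unifSphere d ≤ f x + β / 2 * r ^ 2 := by
  have := isProbabilityMeasure_unifSphere hd
  have hfc := hf.1.continuous
  have h0 := integral_unifSphere_inner (gradient f x)
  have hle : ∀ s : USphere d, f (x + r • (s : Vec d)) ≤
      (f x + β / 2 * r ^ 2) + r * inner ℝ (gradient f x) (s : Vec d) := by
    intro s
    have := hf.2 x (x + r • (s : Vec d))
    simp only [add_sub_cancel_left, real_inner_smul_right, sub_add_cancel_left, norm_neg,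
      norm_smul, norm_eq_of_mem_sphere, mul_one, Real.norm_eq_abs, sq_abs] at this
    linarith
  have hint := integral_mono (μ := unifSphere d)
    (integrable_unifSphere_of_continuous hd (by fun_prop))
    (integrable_unifSphere_of_continuous hd (by fun_prop)) hle
  rw [integral_add (integrable_const _) (integrable_unifSphere_of_continuous hd (by fun_prop)),
    integral_const_mul, h0] at hint
  simpa using hint

theorem ConvexOn.le_integral_sphere {d : ℕ} (hd : 1 ≤ d) {f : Vec d → ℝ}
    (hc : ConvexOn ℝ univ f) (hf : Differentiable ℝ f) (x : Vec d) (r : ℝ) :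
    f x ≤ ∫ s : USphere d, f (x + r • (s : Vec d)) ∂unifSphere d := by
  have := isProbabilityMeasure_unifSphere hd
  have hfc := hf.continuous
  have h0 := integral_unifSphere_inner (gradient f x)
  have hle : ∀ s : USphere d, f x + r * inner ℝ (gradient f x) (s : Vec d) ≤
      f (x + r • (s : Vec d)) := by
    intro s
    have := hc.fderiv_sub_le hf x (x + r • (s : Vec d))
    rw [add_sub_cancel_left, map_smul, smul_eq_mul] at this
    rw [gradient, InnerProductSpace.toDual_symm_apply]
    linarith
  have hint := integral_mono (μ := unifSphere d)
    (integrable_unifSphere_of_continuous hd (by fun_prop))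
    (integrable_unifSphere_of_continuous hd (by fun_prop)) hle
  rw [integral_add (integrable_const _) (integrable_unifSphere_of_continuous hd (by fun_prop)),
    integral_const_mul, h0] at hint
  simpa using hint

theorem hasDerivAt_integral_sphere {d : ℕ} (hd : 1 ≤ d) {L : ℝ} {f : Vec d → ℝ}
    (hf : Differentiable ℝ f) (hL : ∀ y, ‖fderiv ℝ f y‖ ≤ L) (x h : Vec d) (ρ : ℝ) :
    HasDerivAt
      (fun ρ : ℝ => ∫ s : USphere d, f (x + ρ • (s : Vec d)) * inner ℝ h (s : Vec d) ∂unifSphere d)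
      (∫ s : USphere d, fderiv ℝ f (x + ρ • (s : Vec d)) s * inner ℝ h (s : Vec d) ∂unifSphere d)
      ρ := by
  have := isProbabilityMeasure_unifSphere hd
  have hfc := hf.continuous
  refine (hasDerivAt_integral_of_dominated_loc_of_deriv_le (μ := unifSphere d)
    (F := fun (ρ : ℝ) (s : USphere d) => f (x + ρ • (s : Vec d)) * inner ℝ h (s : Vec d))
    (F' := fun (ρ : ℝ) (s : USphere d) =>
      fderiv ℝ f (x + ρ • (s : Vec d)) s * inner ℝ h (s : Vec d))
    (bound := fun _ => L * ‖h‖) (s := univ) Filter.univ_mem ?_ ?_ ?_ ?_ ?_ ?_).2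
  · refine Filter.Eventually.of_forall fun θ => Continuous.aestronglyMeasurable (by fun_prop)
  · exact integrable_unifSphere_of_continuous hd (by fun_prop)
  · refine Measurable.aestronglyMeasurable (Measurable.mul ?_ (by fun_prop))
    have h1 : Continuous fun s : USphere d => x + ρ • (s : Vec d) := by fun_prop
    exact (isBoundedBilinearMap_apply (𝕜 := ℝ) (E := Vec d) (F := ℝ)).continuous.measurable.comp
      (((measurable_fderiv ℝ f).comp h1.measurable).prodMk measurable_subtype_coe)
  · refine Filter.Eventually.of_forall fun s θ _ => ?_
    have hs : ‖(s : Vec d)‖ = 1 := by simp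
    have h1 := (fderiv ℝ f (x + θ • (s : Vec d))).le_opNorm s
    have h2 := norm_inner_le_norm (𝕜 := ℝ) h (s : Vec d)
    rw [hs, mul_one] at h1 h2
    have h3 := hL (x + θ • (s : Vec d))
    have : 0 ≤ L := (norm_nonneg _).trans h3
    rw [norm_mul]
    exact mul_le_mul (h1.trans h3) h2 (norm_nonneg _) this
  · exact integrable_const _
  · refine Filter.Eventually.of_forall fun s θ _ => ?_
    have h1 : HasDerivAt (fun t : ℝ => x + t • (s : Vec d)) (s : Vec d) θ := by
      simpa using ((hasDerivAt_id θ).smul_const (s : Vec d)).const_add x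
    exact ((hf _).hasFDerivAt.comp_hasDerivAt θ h1).mul_const _

/-- Regret of the play `x + r s`, `s` uniform on the sphere, against `u`, in terms of the one-point
gradient estimate. -/
theorem integral_sphere_sub_le {d : ℕ} (hd : 1 ≤ d) {L β : ℝ} (hL : 0 ≤ L) (hβ : 0 ≤ β)
    {f : Vec d → ℝ} (hc : ConvexOn ℝ univ f) (hlip : IsLip L f) (hsm : IsSmooth β f)
    (x u : Vec d) {r : ℝ} (hr : 0 < r) :
    ∫ s : USphere d, f (x + r • (s : Vec d)) ∂unifSphere d - f u ≤
      d / r * ∫ s : USphere d, f (x + r • (s : Vec d)) * inner ℝ (x - u) (s : Vec d) ∂unifSphere d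
        + β * r ^ 2 := by
  have := isProbabilityMeasure_unifSphere hd
  have hf := hsm.1
  have hfc := hf.continuous
  have hD : ∀ y, ‖fderiv ℝ f y‖ ≤ L := hlip.norm_fderiv_le hL
  -- The exponent `d - 1` of the integrating factor is `n`, free of truncated subtraction.
  obtain ⟨n, rfl⟩ : ∃ n, d = n + 1 := ⟨d - 1, by omega⟩
  set h := u - x with hh
  let σ := unifSphere (n + 1)
  let Φ : ℝ → ℝ := fun ρ => ∫ s : USphere (n + 1), f (x + ρ • (s : Vec (n + 1)))
    * inner ℝ h (s : Vec (n + 1)) ∂σ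
  let Φ' : ℝ → ℝ := fun ρ => ∫ s : USphere (n + 1), fderiv ℝ f (x + ρ • (s : Vec (n + 1))) s
    * inner ℝ h (s : Vec (n + 1)) ∂σ
  have hΦ : ∀ ρ, HasDerivAt Φ (Φ' ρ) ρ := fun ρ => hasDerivAt_integral_sphere hd hf hD x h ρ
  set K := f u - f x + β / 2 * r ^ 2 with hK
  -- The divergence identity for `y ↦ f (x + ρ y)`, followed by the gradient inequality from `x + ρ
  -- s` to `u + ρ s`. These points differ by `h` for every `s`.
  have hdiv : ∀ ρ : ℝ, 0 < ρ → ρ ≤ r → n * Φ ρ + ρ * Φ' ρ ≤ ρ * K := by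
    intro ρ hρ hρr
    let F : Vec (n + 1) → ℝ := fun y => f (x + ρ • y)
    have hF : ∀ y, HasFDerivAt F (ρ • fderiv ℝ f (x + ρ • y)) y := by
      intro y
      have h1 : HasFDerivAt (fun y : Vec (n + 1) => x + ρ • y)
          (ρ • ContinuousLinearMap.id ℝ (Vec (n + 1))) y :=
        ((hasFDerivAt_id y).const_smul ρ).const_add x
      have h2 := (hf (x + ρ • y)).hasFDerivAt.comp y h1
      have h3 : (fderiv ℝ f (x + ρ • y)).comp (ρ • ContinuousLinearMap.id ℝ (Vec (n + 1))) =
          ρ • fderiv ℝ f (x + ρ • y) := by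
        ext k
        simp
      rw [h3] at h2
      exact h2
    have hFb : ∀ y, ‖fderiv ℝ F y‖ ≤ ρ * L := by
      intro y
      rw [(hF y).fderiv, norm_smul, Real.norm_eq_abs, abs_of_pos hρ]
      gcongr
      exact hD _
    have hFd : Differentiable ℝ F := fun y => (hF y).differentiableAt
    have hdv := sphere_divergence hd hFd hFb h
    have hFm : ∀ {V : USphere (n + 1) → Vec (n + 1)}, Continuous V → Integrable
        (fun s : USphere (n + 1) => fderiv ℝ F s (V s)) σ :=
      fun hV => integrable_fderiv_apply_sphere hd hFb hV
    have e1 : ∫ s : USphere (n + 1), ((((n + 1 : ℕ) : ℝ) - 1) * F s + fderiv ℝ F s s)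
        * inner ℝ h (s : Vec (n + 1)) ∂σ = n * Φ ρ + ρ * Φ' ρ := by
      have i1 : Integrable (fun s : USphere (n + 1) => n * (F s * inner ℝ h (s : Vec (n + 1)))) σ :=
        integrable_unifSphere_of_continuous hd (by fun_prop)
      have i2 : Integrable (fun s : USphere (n + 1) => ρ * (fderiv ℝ f (x + ρ • (s : Vec (n + 1))) s
          * inner ℝ h (s : Vec (n + 1)))) σ := by
        refine (hFm (V := fun s => (inner ℝ h (s : Vec (n + 1)) : ℝ) • (s : Vec (n + 1)))
          (by fun_prop)).congr (Filter.Eventually.of_forall fun s => ?_)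
        simp only [(hF _).fderiv, smul_apply, map_smul, smul_eq_mul]
        ring
      simp only [Φ, Φ']
      rw [← integral_const_mul, ← integral_const_mul, ← integral_add i1 i2]
      congr 1
      funext s
      simp only [(hF _).fderiv, smul_apply, smul_eq_mul, F]
      push_cast
      ring
    rw [← e1]
    refine (le_of_eq hdv).trans ?_
    have hle : ∀ s : USphere (n + 1), fderiv ℝ F s h ≤
        ρ * (f (u + ρ • (s : Vec (n + 1))) - f (x + ρ • (s : Vec (n + 1)))) := by
      intro s
      have := hc.fderiv_sub_le hf (x + ρ • (s : Vec (n + 1))) (u + ρ • (s : Vec (n + 1)))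
      rw [add_sub_add_right_eq_sub] at this
      rw [(hF _).fderiv, smul_apply, smul_eq_mul]
      gcongr
    have i3 : Integrable (fun s : USphere (n + 1) => f (u + ρ • (s : Vec (n + 1)))) σ :=
      integrable_unifSphere_of_continuous hd (by fun_prop)
    have i4 : Integrable (fun s : USphere (n + 1) => f (x + ρ • (s : Vec (n + 1)))) σ :=
      integrable_unifSphere_of_continuous hd (by fun_prop)
    refine (integral_mono (hFm continuous_const) ((i3.sub i4).const_mul ρ) hle).trans ?_
    rw [integral_const_mul]
    simp only [Pi.sub_apply]
    rw [integral_sub i3 i4]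
    have b1 := hsm.integral_sphere_le hd u ρ
    have b2 := hc.le_integral_sphere hd hf x ρ
    have b3 : β / 2 * ρ ^ 2 ≤ β / 2 * r ^ 2 := by gcongr
    refine mul_le_mul_of_nonneg_left ?_ hρ.le
    simp only [σ]
    linarith
  have hΦ0 : Φ 0 = 0 := by
    simp only [Φ, zero_smul, add_zero, integral_const_mul, σ, integral_unifSphere_inner, mul_zero]
  -- Multiplying `hdiv` by the integrating factor `ρ ^ (n - 1)` gives `χ' ≤ 0`. The case `n = 0` is
  -- covered because the derivative is examined only after multiplication by `ρ`.
  let χ : ℝ → ℝ := fun ρ => ρ ^ n * Φ ρ - K * (ρ ^ (n + 1) / (n + 1))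
  have hχ : ∀ ρ, HasDerivAt χ (n * ρ ^ (n - 1) * Φ ρ + ρ ^ n * Φ' ρ - K * ρ ^ n) ρ := by
    intro ρ
    have h1 := ((hasDerivAt_pow n ρ).mul (hΦ ρ))
    have h2 := (((hasDerivAt_pow (n + 1) ρ).div_const ((n : ℝ) + 1)).const_mul K)
    have h3 : ((n + 1 : ℕ) : ℝ) * ρ ^ (n + 1 - 1) / ((n : ℝ) + 1) = ρ ^ n := by
      have : (n : ℝ) + 1 ≠ 0 := by positivity
      rw [add_tsub_cancel_right]
      push_cast
      field_simp
    rw [h3] at h2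
    exact h1.sub h2
  have hanti : AntitoneOn χ (Icc 0 r) := by
    refine antitoneOn_of_deriv_nonpos (convex_Icc 0 r)
      (fun ρ _ => (hχ ρ).continuousAt.continuousWithinAt)
      (fun ρ _ => (hχ ρ).differentiableAt.differentiableWithinAt) fun ρ hρ => ?_
    rw [interior_Icc] at hρ
    rw [(hχ ρ).deriv]
    have h1 := hdiv ρ hρ.1 hρ.2.le
    have h2 : (n : ℝ) * ρ ^ (n - 1) * ρ = n * ρ ^ n := by
      rcases n with _ | m
      · simp
      · rw [add_tsub_cancel_right, pow_succ]; ring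
    have h3 : ρ * (n * ρ ^ (n - 1) * Φ ρ + ρ ^ n * Φ' ρ - K * ρ ^ n) ≤ 0 := by
      have : ρ * (n * ρ ^ (n - 1) * Φ ρ + ρ ^ n * Φ' ρ - K * ρ ^ n)
          = ρ ^ n * (n * Φ ρ + ρ * Φ' ρ - ρ * K) := by
        linear_combination (Φ ρ) * h2
      rw [this]
      exact mul_nonpos_of_nonneg_of_nonpos (pow_nonneg hρ.1.le _) (by linarith)
    exact nonpos_of_mul_nonpos_right h3 hρ.1
  have hfin := hanti (left_mem_Icc.2 hr.le) (right_mem_Icc.2 hr.le) hr.le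
  have hχ0 : χ 0 = 0 := by simp [χ, hΦ0]
  rw [hχ0] at hfin
  have hn : (0 : ℝ) < n + 1 := by positivity
  have hbd : ((n : ℝ) + 1) / r * Φ r ≤ K := by
    have h1 : r ^ n * (((n : ℝ) + 1) * Φ r - K * r) ≤ 0 := by
      have : r ^ n * (((n : ℝ) + 1) * Φ r - K * r) = (n + 1) * χ r := by
        simp only [χ]
        field_simp
        ring
      rw [this]
      exact mul_nonpos_of_nonneg_of_nonpos hn.le hfin
    have h2 := nonpos_of_mul_nonpos_right h1 (pow_pos hr n)
    rw [div_mul_eq_mul_div, div_le_iff₀ hr]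
    linarith
  have hneg : ∫ s : USphere (n + 1), f (x + r • (s : Vec (n + 1)))
      * inner ℝ (x - u) (s : Vec (n + 1)) ∂unifSphere (n + 1) = - Φ r := by
    simp only [Φ, σ]
    rw [← integral_neg]
    congr 1
    funext s
    rw [hh, ← neg_sub u x, inner_neg_left]
    ring
  rw [hneg]
  -- The smoothing error `β / 2 * r ^ 2` enters twice, here at `x` and through `K` at `u`. This is
  -- the total `β * r ^ 2`.
  have b1 := hsm.integral_sphere_le hd x r
  push_cast
  linarith

/-! ### Projected gradient descent on the unit ball. -/

/-- The metric projection onto the closed unit ball. -/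
noncomputable def ballProj {d : ℕ} (p : Vec d) : Vec d := (max 1 ‖p‖)⁻¹ • p

theorem measurable_ballProj {d : ℕ} : Measurable (ballProj (d := d)) :=
  (measurable_const.max measurable_norm).inv.smul measurable_id

theorem norm_ballProj_le {d : ℕ} (p : Vec d) : ‖ballProj p‖ ≤ 1 := by
  have : 0 < max 1 ‖p‖ := lt_max_of_lt_left one_pos
  rw [ballProj, norm_smul, norm_inv, Real.norm_of_nonneg this.le, inv_mul_le_iff₀ this, mul_one]
  exact le_max_right _ _

theorem inner_sub_ballProj_nonpos {d : ℕ} (p y : Vec d) (hy : ‖y‖ ≤ 1) :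
    inner ℝ (p - ballProj p) (y - ballProj p) ≤ (0 : ℝ) := by
  rcases le_or_gt ‖p‖ 1 with hp | hp
  · simp [ballProj, hp]
  · rw [ballProj, max_eq_right hp.le]
    have hp0 : 0 < ‖p‖ := one_pos.trans hp
    have h1 : p - ‖p‖⁻¹ • p = (1 - ‖p‖⁻¹) • p := by module
    rw [h1, real_inner_smul_left, inner_sub_right, real_inner_smul_right, real_inner_self_eq_norm_sq]
    have h2 : ‖p‖⁻¹ ≤ 1 := inv_le_one_of_one_le₀ hp.le
    have h3 : ‖p‖⁻¹ * ‖p‖ ^ 2 = ‖p‖ := by field_simp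
    have h4 := real_inner_le_norm p y
    have h5 : ‖p‖ * ‖y‖ ≤ ‖p‖ := mul_le_of_le_one_right hp0.le hy
    rw [h3]
    exact mul_nonpos_of_nonneg_of_nonpos (by linarith) (by linarith)

/-- Completing the square turns the minimizer into the projection of `z - (η / 2) • g`. The
inequality is the variational characterization of that projection. -/
theorem prox_inner_nonpos {d : ℕ} {η : ℝ} {z g z' : Vec d} (hz' : ‖z'‖ ≤ 1)
    (hmin : IsMinOn (fun x => η * inner ℝ x g + ‖z - x‖ ^ 2) (Metric.closedBall 0 1) z')
    {y : Vec d} (hy : ‖y‖ ≤ 1) :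
    inner ℝ (z - (η / 2) • g - z') (y - z') ≤ (0 : ℝ) := by
  set p := z - (η / 2) • g with hp
  have hz'm : z' ∈ Metric.closedBall (0 : Vec d) 1 := by simpa using hz'
  have hφ : ∀ x, ‖p - x‖ ^ 2 = η * inner ℝ x g + ‖z - x‖ ^ 2
      + (η ^ 2 / 4 * ‖g‖ ^ 2 - η * inner ℝ z g) := by
    intro x
    have : p - x = (z - x) - (η / 2) • g := by rw [hp]; module
    rw [this, norm_sub_sq_real, real_inner_smul_right, inner_sub_left, norm_smul, mul_pow,
      Real.norm_eq_abs, sq_abs]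
    ring
  have hle : ∀ w ∈ Metric.closedBall (0 : Vec d) 1, ‖p - z'‖ ≤ ‖p - w‖ := by
    intro w hw
    have h1 : η * inner ℝ z' g + ‖z - z'‖ ^ 2 ≤ η * inner ℝ w g + ‖z - w‖ ^ 2 := hmin hw
    refine le_of_sq_le_sq ?_ (norm_nonneg _)
    rw [hφ, hφ]
    linarith
  have hinf : ‖p - z'‖ = ⨅ w : Metric.closedBall (0 : Vec d) 1, ‖p - w‖ := by
    have : Nonempty (Metric.closedBall (0 : Vec d) 1) := ⟨⟨z', hz'm⟩⟩
    refine le_antisymm (le_ciInf fun w => hle w w.2) ?_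
    exact ciInf_le ⟨0, by rintro _ ⟨w, rfl⟩; exact norm_nonneg _⟩ (⟨z', hz'm⟩ :
      Metric.closedBall (0 : Vec d) 1)
  exact (norm_eq_iInf_iff_real_inner_le_zero (convex_closedBall _ _) hz'm).1 hinf y (by simpa using hy)

/-- The explicit formula is what makes the directions measurable: a run is only known to pick some
minimizer. -/
theorem prox_eq_ballProj {d : ℕ} {η : ℝ} {z g z' : Vec d} (hz' : ‖z'‖ ≤ 1)
    (hmin : IsMinOn (fun x => η * inner ℝ x g + ‖z - x‖ ^ 2) (Metric.closedBall 0 1) z') :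
    z' = ballProj (z - (η / 2) • g) := by
  set p := z - (η / 2) • g with hp
  have h1 := prox_inner_nonpos hz' hmin (norm_ballProj_le p)
  have h2 := inner_sub_ballProj_nonpos p z' hz'
  rw [← hp] at h1
  set q := ballProj p
  have h3 : inner ℝ (z' - q) (z' - q) = inner ℝ (p - z') (q - z') + inner ℝ (p - q) (z' - q) := by
    simp only [inner_sub_left, inner_sub_right]
    ring
  have h4 : inner ℝ (z' - q) (z' - q) ≤ (0 : ℝ) := by rw [h3]; linarith
  rw [real_inner_self_nonpos, sub_eq_zero] at h4
  exact h4

theorem prox_step {d : ℕ} {η : ℝ} {z g z' : Vec d} (hz' : ‖z'‖ ≤ 1)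
    (hmin : IsMinOn (fun x => η * inner ℝ x g + ‖z - x‖ ^ 2) (Metric.closedBall 0 1) z')
    {y : Vec d} (hy : ‖y‖ ≤ 1) :
    η * inner ℝ (z - y) g ≤ ‖z - y‖ ^ 2 - ‖z' - y‖ ^ 2 + η ^ 2 / 4 * ‖g‖ ^ 2 := by
  have h1 := prox_inner_nonpos hz' hmin hy
  set p := z - (η / 2) • g with hp
  have h2 : ‖p - y‖ ^ 2 = ‖z - y‖ ^ 2 - η * inner ℝ (z - y) g + η ^ 2 / 4 * ‖g‖ ^ 2 := by
    have : p - y = (z - y) - (η / 2) • g := by rw [hp]; module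
    rw [this, norm_sub_sq_real, real_inner_smul_right, norm_smul, mul_pow,
      Real.norm_eq_abs, sq_abs]
    ring
  have h3 : ‖p - y‖ ^ 2 = ‖p - z'‖ ^ 2 - 2 * inner ℝ (p - z') (y - z') + ‖z' - y‖ ^ 2 := by
    have : p - y = (p - z') - (y - z') := by module
    rw [this, norm_sub_sq_real, norm_sub_rev y z']
  nlinarith [sq_nonneg ‖p - z'‖]

theorem sum_inner_prox_le {d T : ℕ} {η G : ℝ} (hη : 0 < η) {z g : ℕ → Vec d}
    (h0 : z 0 = 0) (hz : ∀ t < T, ‖z (t + 1)‖ ≤ 1)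
    (hmin : ∀ t < T, IsMinOn (fun x => η * inner ℝ x (g t) + ‖z t - x‖ ^ 2)
      (Metric.closedBall 0 1) (z (t + 1)))
    (hg : ∀ t < T, ‖g t‖ ≤ G) {y : Vec d} (hy : ‖y‖ ≤ 1) :
    ∑ t ∈ Finset.range T, inner ℝ (z t - y) (g t) ≤ 1 / η + η / 4 * (T * G ^ 2) := by
  have key : ∀ n ≤ T, η * ∑ t ∈ Finset.range n, inner ℝ (z t - y) (g t) ≤
      ‖y‖ ^ 2 - ‖z n - y‖ ^ 2 + η ^ 2 / 4 * (n * G ^ 2) := by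
    intro n
    induction n with
    | zero => simp [h0]
    | succ n ih =>
      intro hn
      have h1 := prox_step (hz n hn) (hmin n hn) hy
      have h2 : η ^ 2 / 4 * ‖g n‖ ^ 2 ≤ η ^ 2 / 4 * G ^ 2 := by
        gcongr
        exact hg n hn
      have h3 := ih (by omega)
      rw [Finset.sum_range_succ, mul_add]
      push_cast
      linarith
  have h1 := key T le_rfl
  have h2 : ‖y‖ ^ 2 ≤ 1 := pow_le_one₀ (norm_nonneg _) hy
  have h3 : (1 / η + η / 4 * (T * G ^ 2)) = (1 + η ^ 2 / 4 * (T * G ^ 2)) / η := by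
    field_simp
  rw [h3, le_div_iff₀ hη]
  nlinarith [sq_nonneg ‖z T - y‖]

/-! ### Pathwise bounds for scales, estimates and the linearized regret. -/

theorem deriv_surrogate {d : ℕ} (β δ : ℝ) (z g : Vec d) (v : ℝ) :
    deriv (surrogate β δ z g) v = inner ℝ z g + 2 * β * δ ^ 2 * v := by
  have h : HasDerivAt (surrogate β δ z g)
      (1 * inner ℝ z g + β * δ ^ 2 * ((2 : ℕ) * v ^ (2 - 1))) v :=
    ((hasDerivAt_id v).mul_const _).add ((hasDerivAt_pow 2 v).const_mul _)
  rw [h.deriv]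
  norm_num
  ring

theorem ScaleAlg.play_congr (A : ScaleAlg) {g g' : ℕ → ℝ} {t : ℕ} (h : ∀ i < t, g i = g' i) :
    A.play g t = A.play g' t := by
  unfold ScaleAlg.play
  congr 1
  funext i
  exact h i i.2

/-- The interface speaks of feedback bounded in all `T` rounds. A play depends only on earlier
feedback, so the remaining values may be replaced by `0`; this allows induction over rounds. -/
theorem ImplementsScale.mem_of_prefix {A : ScaleAlg} {l : Set ℝ} {T : ℕ} {G Λ : ℝ} (hG : 0 ≤ G)
    (hA : ImplementsScale A l T G Λ) {g : ℕ → ℝ} {t : ℕ} (ht : t < T) (hg : ∀ i < t, |g i| ≤ G) :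
    A.play g t ∈ l := by
  rw [A.play_congr (g' := fun i => if i < t then g i else 0) fun i hi => by simp [hi]]
  refine hA.mem _ (fun i _ => ?_) t ht
  by_cases hi : i < t
  · simpa [hi] using hg i hi
  · simpa [hi] using hG

/-- As `f 0 = 0`, the observed loss is proportional to the scale `v`, which cancels against the
factor `1 / v` of the estimate. -/
theorem norm_estimate_le {d : ℕ} {L δ v : ℝ} (hL : 0 ≤ L) (hδ : 0 < δ) (hδ1 : δ ≤ 1) (hv : 0 < v)
    {f : Vec d → ℝ} (hf : IsLip L f) (hf0 : f 0 = 0) {z : Vec d} (hz : ‖z‖ ≤ 1) (s : USphere d) :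
    |f (v • (z + δ • (s : Vec d)))| ≤ 2 * L * v ∧
    ‖((d : ℝ) / (v * δ) * f (v • (z + δ • (s : Vec d)))) • (s : Vec d)‖ ≤ 2 * d * L / δ := by
  have h1 : ‖v • (z + δ • (s : Vec d))‖ ≤ v * 2 := by
    rw [norm_smul, Real.norm_of_nonneg hv.le]
    gcongr
    refine (norm_add_le _ _).trans ?_
    rw [norm_smul, norm_eq_of_mem_sphere, Real.norm_of_nonneg hδ.le]
    linarith
  have h2 := hf 0 (v • (z + δ • (s : Vec d)))
  rw [hf0, sub_zero, sub_zero] at h2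
  have h3 : |f (v • (z + δ • (s : Vec d)))| ≤ 2 * L * v := by
    refine h2.trans ?_
    calc L * _ ≤ L * (v * 2) := by gcongr
      _ = _ := by ring
  refine ⟨h3, ?_⟩
  rw [norm_smul, norm_eq_of_mem_sphere, mul_one, norm_mul, Real.norm_of_nonneg (by positivity)]
  calc (d : ℝ) / (v * δ) * _ ≤ (d : ℝ) / (v * δ) * (2 * L * v) := by gcongr; exact h3
    _ = _ := by field_simp

theorem abs_deriv_surrogate_le {d : ℕ} {L β δ v : ℝ} (hβ : 0 ≤ β) (hδ : 0 < δ)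
    (hv : v ∈ Ioc 0 (1 / δ ^ 3)) {z g : Vec d} (hz : ‖z‖ ≤ 1) (hg : ‖g‖ ≤ 2 * d * L / δ) :
    |deriv (surrogate β δ z g) v| ≤ feedbackBound d L β δ := by
  rw [deriv_surrogate]
  have h1 : |inner ℝ z g| ≤ 2 * d * L / δ := by
    refine (abs_real_inner_le_norm z g).trans ?_
    exact (mul_le_of_le_one_left (norm_nonneg _) hz).trans hg
  have h2 : |2 * β * δ ^ 2 * v| ≤ 2 * β / δ := by
    rw [abs_of_nonneg (mul_nonneg (by positivity) hv.1.le)]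
    calc 2 * β * δ ^ 2 * v ≤ 2 * β * δ ^ 2 * (1 / δ ^ 3) := by gcongr; exact hv.2
      _ = _ := by field_simp
  refine (abs_add_le _ _).trans ?_
  rw [feedbackBound, add_div]
  exact add_le_add h1 h2

/-- The upper bound for the regret of round `t` in terms of the gradient estimate. -/
noncomputable def linearizedGap {d : ℕ} (β δ v : ℝ) (z g u : Vec d) : ℝ :=
  surrogate β δ z g v - inner ℝ u g

theorem sum_linearizedGap_le {d T : ℕ} {β δ η G Λ K : ℝ} {l : Set ℝ} (hβ : 0 ≤ β) (hη : 0 < η)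
    {A : ScaleAlg} (hA : ImplementsScale A l T G Λ) {v : ℕ → ℝ} {z g : ℕ → Vec d}
    (hv : ∀ t < T, v t = A.play (fun i => deriv (surrogate β δ (z i) (g i)) (v i)) t)
    (hfb : ∀ t < T, |deriv (surrogate β δ (z t) (g t)) (v t)| ≤ G)
    (h0 : z 0 = 0) (hz : ∀ t < T, ‖z (t + 1)‖ ≤ 1)
    (hmin : ∀ t < T, IsMinOn (fun x => η * inner ℝ x (g t) + ‖z t - x‖ ^ 2)
      (Metric.closedBall 0 1) (z (t + 1)))
    (hg : ∀ t < T, ‖g t‖ ≤ K) {a : ℝ} (ha : a ∈ l) (ha0 : 0 ≤ a) {y : Vec d} (hy : ‖y‖ ≤ 1) :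
    ∑ t ∈ Finset.range T, linearizedGap β δ (v t) (z t) (g t) (a • y) ≤
      Λ * (1 + a * G * √(T : ℝ)) + a * (1 / η + η / 4 * (T * K ^ 2)) + T * (β * δ ^ 2 * a ^ 2) := by
  have h1 := hA.regret _ hfb a ha
  rw [abs_of_nonneg ha0] at h1
  have h2 := mul_le_mul_of_nonneg_left (sum_inner_prox_le hη h0 hz hmin hg hy) ha0
  have h3 : ∑ t ∈ Finset.range T, linearizedGap β δ (v t) (z t) (g t) (a • y) ≤
      ∑ t ∈ Finset.range T, ((A.play (fun i => deriv (surrogate β δ (z i) (g i)) (v i)) t - a)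
        * deriv (surrogate β δ (z t) (g t)) (v t) + a * inner ℝ (z t - y) (g t)
        + β * δ ^ 2 * a ^ 2) := by
    refine Finset.sum_le_sum fun t ht => ?_
    rw [← hv t (Finset.mem_range.1 ht), deriv_surrogate, linearizedGap, surrogate, inner_sub_left,
      real_inner_smul_left]
    -- The exact gap between the surrogate and its tangent at `v t`, evaluated at `a`.
    have : 0 ≤ β * δ ^ 2 * (v t - a) ^ 2 := by positivity
    linarith
  rw [Finset.sum_add_distrib, Finset.sum_add_distrib, ← Finset.mul_sum, Finset.sum_const,
    Finset.card_range, nsmul_eq_mul] at h3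
  linarith

/-! ### Measurability and the expected one-round inequality. -/

theorem measurable_eval_of_continuous {Ω : Type*} [MeasurableSpace Ω] {d : ℕ} {f : Ω → Vec d → ℝ}
    (hc : ∀ ω, Continuous (f ω)) (hm : ∀ x, Measurable fun ω => f ω x) {W : Ω → Vec d}
    (hW : Measurable W) : Measurable fun ω => f ω (W ω) := by
  have h := (stronglyMeasurable_uncurry_of_continuous_of_stronglyMeasurable
    (u := fun x ω => f ω x) hc fun x => (hm x).stronglyMeasurable).measurable
  exact h.comp (hW.prodMk measurable_id)

theorem measurable_play_estimate {Ω : Type*} [MeasurableSpace Ω] {d : ℕ} {f : Ω → Vec d → ℝ}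
    (hc : ∀ ω, Continuous (f ω)) (hm : ∀ x, Measurable fun ω => f ω x) {v : Ω → ℝ}
    (hv : Measurable v) {z : Ω → Vec d} (hz : Measurable z) {s : Ω → USphere d} (hs : Measurable s)
    (δ : ℝ) :
    Measurable (fun ω => f ω (v ω • (z ω + δ • (s ω : Vec d)))) ∧
    Measurable (fun ω =>
      ((d : ℝ) / (v ω * δ) * f ω (v ω • (z ω + δ • (s ω : Vec d)))) • (s ω : Vec d)) := by
  have hs' : Measurable fun ω => (s ω : Vec d) := measurable_subtype_coe.comp hs
  have hW : Measurable fun ω => v ω • (z ω + δ • (s ω : Vec d)) :=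
    hv.smul (hz.add (hs'.const_smul δ))
  have hf := measurable_eval_of_continuous hc hm hW
  exact ⟨hf, ((measurable_const.div (hv.mul_const δ)).mul hf).smul hs'⟩

theorem measurable_linearizedGap {Ω : Type*} [MeasurableSpace Ω] {d : ℕ} (β δ : ℝ) {v : Ω → ℝ}
    (hv : Measurable v) {z g : Ω → Vec d} (hz : Measurable z) (hg : Measurable g) (u : Vec d) :
    Measurable fun ω => linearizedGap β δ (v ω) (z ω) (g ω) u := by
  unfold linearizedGap surrogate
  exact ((hv.mul (hz.inner hg)).add ((hv.pow_const 2).const_mul _)).sub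
    (measurable_const.inner hg)

theorem abs_linearizedGap_le {d : ℕ} {β δ v V K : ℝ} (hβ : 0 ≤ β) (hv : 0 ≤ v) (hvV : v ≤ V)
    {z g : Vec d} (hz : ‖z‖ ≤ 1) (hg : ‖g‖ ≤ K) (u : Vec d) :
    |linearizedGap β δ v z g u| ≤ V * K + β * δ ^ 2 * V ^ 2 + ‖u‖ * K := by
  have hK : 0 ≤ K := (norm_nonneg _).trans hg
  have h1 : |inner ℝ z g| ≤ K := (abs_real_inner_le_norm z g).trans
    ((mul_le_of_le_one_left (norm_nonneg _) hz).trans hg)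
  have h2 : |inner ℝ u g| ≤ ‖u‖ * K := (abs_real_inner_le_norm u g).trans (by gcongr)
  have h3 : |v * inner ℝ z g| ≤ V * K := by
    rw [abs_mul, abs_of_nonneg hv]
    exact mul_le_mul hvV h1 (abs_nonneg _) (hv.trans hvV)
  have h4 : |β * δ ^ 2 * v ^ 2| ≤ β * δ ^ 2 * V ^ 2 := by
    rw [abs_of_nonneg (by positivity)]
    gcongr
  unfold linearizedGap surrogate
  exact (abs_sub _ _).trans (add_le_add ((abs_add_le _ _).trans (add_le_add h3 h4)) h2)

theorem integral_sphere_loss_sub_linearizedGap_nonpos {d : ℕ} (hd : 1 ≤ d) {L β δ v : ℝ}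
    (hL : 0 ≤ L) (hβ : 0 ≤ β) (hδ : 0 < δ) (hv : 0 < v) {f : Vec d → ℝ} (hc : ConvexOn ℝ univ f)
    (hlip : IsLip L f) (hsm : IsSmooth β f) (z u : Vec d) :
    ∫ s : USphere d, (f (v • (z + δ • (s : Vec d))) - f u - linearizedGap β δ v z
      (((d : ℝ) / (v * δ) * f (v • (z + δ • (s : Vec d)))) • (s : Vec d)) u) ∂unifSphere d ≤ 0 := by
  have := isProbabilityMeasure_unifSphere hd
  have hfc := hlip.continuous
  have h := integral_sphere_sub_le hd hL hβ hc hlip hsm (v • z) u (mul_pos hv hδ)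
  have hpt : ∀ s : USphere d, f (v • (z + δ • (s : Vec d))) - f u - linearizedGap β δ v z
      (((d : ℝ) / (v * δ) * f (v • (z + δ • (s : Vec d)))) • (s : Vec d)) u =
      (f (v • z + (v * δ) • (s : Vec d)) - (f u + β * (v * δ) ^ 2)) - d / (v * δ) *
      (f (v • z + (v * δ) • (s : Vec d)) * inner ℝ (v • z - u) (s : Vec d)) := by
    intro s
    rw [smul_add, smul_smul]
    simp only [linearizedGap, surrogate, real_inner_smul_right, inner_sub_left, real_inner_smul_left]
    ring
  simp_rw [hpt]
  have i1 : Integrable (fun s : USphere d => f (v • z + (v * δ) • (s : Vec d))) (unifSphere d) :=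
    integrable_unifSphere_of_continuous hd (by fun_prop)
  have i2 : Integrable (fun s : USphere d => f (v • z + (v * δ) • (s : Vec d))
      * inner ℝ (v • z - u) (s : Vec d)) (unifSphere d) :=
    integrable_unifSphere_of_continuous hd (by fun_prop)
  have i3 : Integrable (fun s : USphere d =>
      f (v • z + (v * δ) • (s : Vec d)) - (f u + β * (v * δ) ^ 2)) (unifSphere d) :=
    i1.sub (integrable_const _)
  rw [integral_sub i3 (i2.const_mul _), integral_sub i1 (integrable_const _), integral_const_mul]
  simp only [integral_const, probReal_univ, one_smul]
  linarith

/-- `X` encodes the past, which fixes loss, scale and centre. By independence the law of `(X, s)` is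
a product, so Fubini reduces the claim to the spherical inequality for each fixed past and no
conditional expectation is needed. -/
theorem integral_loss_sub_linearizedGap_nonpos {Ω Ω' : Type*} [MeasurableSpace Ω]
    [MeasurableSpace Ω'] {P : Measure Ω} [IsProbabilityMeasure P] {d : ℕ} (hd : 1 ≤ d)
    {L β δ V : ℝ} (hL : 0 ≤ L) (hβ : 0 ≤ β) (hδ : 0 < δ) (hδ1 : δ ≤ 1)
    {X : Ω → Ω'} (hX : Measurable X) {s : Ω → USphere d} (hs : Measurable s)
    (hlaw : P.map s = unifSphere d) (hind : IndepFun X s P) {f : Ω' → Vec d → ℝ}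
    (hc : ∀ ω, ConvexOn ℝ univ (f ω)) (hlip : ∀ ω, IsLip L (f ω)) (hsm : ∀ ω, IsSmooth β (f ω))
    (hf0 : ∀ ω, f ω 0 = 0) (hm : ∀ x, Measurable fun ω => f ω x) {v : Ω' → ℝ} (hv : Measurable v)
    (hv0 : ∀ ω, 0 < v ω) (hvV : ∀ ω, v ω ≤ V) {z : Ω' → Vec d} (hz : Measurable z)
    (hz1 : ∀ ω, ‖z ω‖ ≤ 1) (u : Vec d) :
    ∫ ω, (f (X ω) (v (X ω) • (z (X ω) + δ • (s ω : Vec d))) - f (X ω) u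
      - linearizedGap β δ (v (X ω)) (z (X ω)) (((d : ℝ) / (v (X ω) * δ) *
        f (X ω) (v (X ω) • (z (X ω) + δ • (s ω : Vec d)))) • (s ω : Vec d)) u) ∂P ≤ 0 := by
  have := isProbabilityMeasure_unifSphere hd
  have : IsProbabilityMeasure (P.map X) := Measure.isProbabilityMeasure_map hX.aemeasurable
  let φ : Ω' × USphere d → ℝ := fun p => f p.1 (v p.1 • (z p.1 + δ • (p.2 : Vec d))) - f p.1 u
      - linearizedGap β δ (v p.1) (z p.1) (((d : ℝ) / (v p.1 * δ) *
        f p.1 (v p.1 • (z p.1 + δ • (p.2 : Vec d)))) • (p.2 : Vec d)) u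
  have hest := measurable_play_estimate (Ω := Ω' × USphere d) (f := fun p => f p.1)
    (fun p => (hlip p.1).continuous) (fun x => (hm x).comp measurable_fst)
    (hv.comp measurable_fst) (hz.comp measurable_fst) measurable_snd δ
  have hφm : Measurable φ :=
    (hest.1.sub ((hm u).comp measurable_fst)).sub (measurable_linearizedGap β δ
      (hv.comp measurable_fst) (hz.comp measurable_fst) hest.2 u)
  have hφb : ∀ p, ‖φ p‖ ≤ 2 * L * V + L * ‖u‖ +
      (V * (2 * d * L / δ) + β * δ ^ 2 * V ^ 2 + ‖u‖ * (2 * d * L / δ)) := by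
    intro p
    obtain ⟨h1, h2⟩ := norm_estimate_le hL hδ hδ1 (hv0 p.1) (hlip p.1) (hf0 p.1) (hz1 p.1) p.2
    have h3 := abs_linearizedGap_le (δ := δ) hβ (hv0 p.1).le (hvV p.1) (hz1 p.1) h2 u
    have h4 := hlip p.1 0 u
    rw [hf0, sub_zero, sub_zero] at h4
    have h5 : 2 * L * v p.1 ≤ 2 * L * V := by gcongr; exact hvV _
    exact (abs_sub _ _).trans (add_le_add ((abs_sub _ _).trans (add_le_add (h1.trans h5) h4)) h3)
  have hmap : P.map (fun ω => (X ω, s ω)) = (P.map X).prod (unifSphere d) := by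
    rw [← hlaw]
    exact (indepFun_iff_map_prod_eq_prod_map_map hX.aemeasurable hs.aemeasurable).1 hind
  have h1 : ∫ ω, φ (X ω, s ω) ∂P = ∫ p, φ p ∂((P.map X).prod (unifSphere d)) := by
    rw [← hmap, integral_map (hX.prodMk hs).aemeasurable hφm.aestronglyMeasurable]
  change ∫ ω, φ (X ω, s ω) ∂P ≤ 0
  rw [h1, integral_prod _ (Integrable.of_bound hφm.aestronglyMeasurable _
    (Filter.Eventually.of_forall hφb))]
  exact integral_nonpos fun x => integral_sphere_loss_sub_linearizedGap_nonpos hd hL hβ hδ (hv0 x)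
    (hc x) (hlip x) (hsm x) (z x) u

/-! ### Runs of the algorithm: bounds, adaptedness and expected regret. -/

theorem one_sub_zero_smul_set {d : ℕ} (Z : Set (Vec d)) : ((1 : ℝ) - 0) • Z = Z := by
  rw [sub_zero, one_smul]

/-- The bounds are mutually dependent: past feedback bounds put the scale in the segment, and the
scale bounds the new feedback. Strong induction over rounds resolves this. -/
theorem IsBanditRun.bounds {d : ℕ} {Ω : Type*} {T : ℕ} {L β δ η Λ : ℝ} {A : ScaleAlg}
    {loss : ℕ → Ω → Vec d → ℝ} {s : ℕ → Ω → USphere d} {v : ℕ → Ω → ℝ} {z w ghat : ℕ → Ω → Vec d}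
    (hL : 0 ≤ L) (hβ : 0 ≤ β) (hδ : 0 < δ) (hδ1 : δ ≤ 1)
    (hA : ImplementsScale A (Ioc 0 (1 / δ ^ 3)) T (feedbackBound d L β δ) Λ)
    (hrun : IsBanditRun T β δ 0 η (Metric.closedBall 0 1) A loss s v z w ghat)
    (hlip : ∀ t < T, ∀ ω, IsLip L (loss t ω)) (h0 : ∀ t < T, ∀ ω, loss t ω 0 = 0) (ω : Ω) :
    ∀ t < T, v t ω ∈ Ioc 0 (1 / δ ^ 3) ∧ ‖z t ω‖ ≤ 1 ∧ |loss t ω (w t ω)| ≤ 2 * L * v t ω ∧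
      ‖ghat t ω‖ ≤ 2 * d * L / δ ∧
      |deriv (surrogate β δ (z t ω) (ghat t ω)) (v t ω)| ≤ feedbackBound d L β δ := by
  have hG : 0 ≤ feedbackBound d L β δ := by unfold feedbackBound; positivity
  intro t
  induction t using Nat.strong_induction_on with
  | _ t ih =>
    intro ht
    have hv : v t ω ∈ Ioc 0 (1 / δ ^ 3) := by
      rw [hrun.scale t ht ω]
      exact hA.mem_of_prefix hG ht fun i hi => (ih i hi (hi.trans ht)).2.2.2.2
    have hz : ‖z t ω‖ ≤ 1 := by
      rcases t with _ | t
      · simp [hrun.init]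
      · have := hrun.update_mem t (by omega) ω
        rw [one_sub_zero_smul_set] at this
        simpa using this
    have hest := norm_estimate_le hL hδ hδ1 hv.1 (hlip t ht ω) (h0 t ht ω) hz (s t ω)
    rw [← hrun.point t ht ω, ← hrun.estimate t ht ω] at hest
    exact ⟨hv, hz, hest.1, hest.2, abs_deriv_surrogate_le hβ hδ hv hz hest.2⟩

theorem IsBanditRun.measurable {d : ℕ} {Ω : Type*} [mΩ : MeasurableSpace Ω] {P : Measure Ω}
    {ℱ : Filtration ℕ mΩ} {T : ℕ} {L β δ η Λ G : ℝ} {l : Set ℝ} {A : ScaleAlg}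
    {loss : ℕ → Ω → Vec d → ℝ} {s : ℕ → Ω → USphere d} {v : ℕ → Ω → ℝ} {z w ghat : ℕ → Ω → Vec d}
    (hA : ImplementsScale A l T G Λ) (hloss : IsLossProcess ℱ T L β loss)
    (hs : IsSampling P ℱ T s)
    (hrun : IsBanditRun T β δ 0 η (Metric.closedBall 0 1) A loss s v z w ghat) :
    ∀ t < T, Measurable[ℱ t] (v t) ∧ Measurable[ℱ t] (z t) ∧
      Measurable[ℱ (t + 1)] (fun ω => loss t ω (w t ω)) ∧ Measurable[ℱ (t + 1)] (ghat t) := by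
  intro t
  induction t using Nat.strong_induction_on with
  | _ t ih =>
    intro ht
    have hz : Measurable[ℱ t] (z t) := by
      rcases t with _ | t
      · have : z 0 = fun _ => 0 := funext hrun.init
        rw [this]
        exact measurable_const
      · obtain ⟨_, hzt, _, hgt⟩ := ih t (by omega) (by omega)
        have : z (t + 1) = fun ω => ballProj (z t ω - (η / 2) • ghat t ω) := by
          funext ω
          have h1 := hrun.update_mem t (by omega) ω
          have h2 := hrun.update_min t (by omega) ω
          rw [one_sub_zero_smul_set] at h1 h2
          exact prox_eq_ballProj (by simpa using h1) h2
        rw [this]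
        exact measurable_ballProj.comp
          ((hzt.mono (ℱ.mono (Nat.le_succ t)) le_rfl).sub (hgt.const_smul (η / 2)))
    have hv : Measurable[ℱ t] (v t) := by
      have : v t = fun ω => A t fun i : Fin t =>
          inner ℝ (z i ω) (ghat i ω) + 2 * β * δ ^ 2 * v i ω := by
        funext ω
        rw [hrun.scale t ht ω]
        simp only [ScaleAlg.play, deriv_surrogate]
      rw [this]
      refine (hA.measurable t ht).comp (@measurable_pi_lambda _ _ _ (ℱ t) _ _ fun i => ?_)
      obtain ⟨hvi, hzi, _, hgi⟩ := ih i i.2 (i.2.trans ht)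
      have hle : ℱ (i : ℕ) ≤ ℱ t := ℱ.mono i.2.le
      have hle' : ℱ ((i : ℕ) + 1) ≤ ℱ t := ℱ.mono i.2
      exact ((hzi.mono hle le_rfl).inner (hgi.mono hle' le_rfl)).add
        ((hvi.mono hle le_rfl).const_mul _)
    have hle : ℱ t ≤ ℱ (t + 1) := ℱ.mono (Nat.le_succ t)
    have hest := @measurable_play_estimate Ω (ℱ (t + 1)) d (loss t)
      (fun ω => (hloss.lipschitz t ht ω).continuous)
      (fun x => (hloss.adapted t ht x).mono hle le_rfl) (v t) (hv.mono hle le_rfl) (z t)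
      (hz.mono hle le_rfl) (s t) (hs.measurable t ht) δ
    refine ⟨hv, hz, ?_, ?_⟩
    · have : w t = fun ω => v t ω • (z t ω + δ • (s t ω : Vec d)) := funext (hrun.point t ht)
      rw [this]
      exact hest.1
    · have : ghat t = fun ω => ((d : ℝ) / (v t ω * δ) * loss t ω (v t ω • (z t ω +
          δ • (s t ω : Vec d)))) • (s t ω : Vec d) := by
        funext ω
        rw [hrun.estimate t ht ω, hrun.point t ht ω]
      rw [this]
      exact hest.2

theorem IsBanditRun.integral_regret_le {d : ℕ} (hd : 1 ≤ d) {Ω : Type*} [mΩ : MeasurableSpace Ω]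
    {P : Measure Ω} [IsProbabilityMeasure P]
    {ℱ : Filtration ℕ mΩ} {T : ℕ} {L β δ η Λ : ℝ} {A : ScaleAlg}
    {loss : ℕ → Ω → Vec d → ℝ} {s : ℕ → Ω → USphere d} {v : ℕ → Ω → ℝ} {z w ghat : ℕ → Ω → Vec d}
    (hL : 0 ≤ L) (hβ : 0 ≤ β) (hδ : 0 < δ) (hδ1 : δ ≤ 1) (hη : 0 < η)
    (hA : ImplementsScale A (Ioc 0 (1 / δ ^ 3)) T (feedbackBound d L β δ) Λ)
    (hloss : IsLossProcess ℱ T L β loss) (hs : IsSampling P ℱ T s)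
    (hrun : IsBanditRun T β δ 0 η (Metric.closedBall 0 1) A loss s v z w ghat) :
    (∀ u, Integrable (regret T loss w u) P) ∧
    ∀ a ∈ Ioc 0 (1 / δ ^ 3), ∀ y : Vec d, ‖y‖ ≤ 1 → ∫ ω, regret T loss w (a • y) ω ∂P ≤
      Λ * (1 + a * feedbackBound d L β δ * √(T : ℝ))
        + a * (1 / η + η / 4 * (T * (2 * d * L / δ) ^ 2)) + T * (β * δ ^ 2 * a ^ 2) := by
  have hb := hrun.bounds hL hβ hδ hδ1 hA hloss.lipschitz hloss.zero
  have hm := hrun.measurable hA hloss hs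
  have i1 : ∀ u, ∀ t ∈ Finset.range T, Integrable (fun ω => loss t ω (w t ω) - loss t ω u) P := by
    intro u t ht
    rw [Finset.mem_range] at ht
    refine Integrable.sub ?_ ?_
    · refine Integrable.of_bound
        ((hm t ht).2.2.1.mono (ℱ.le _) le_rfl).aestronglyMeasurable (2 * L * (1 / δ ^ 3))
        (Filter.Eventually.of_forall fun ω => (hb ω t ht).2.2.1.trans ?_)
      have := (hb ω t ht).1.2
      gcongr
    · refine Integrable.of_bound
        ((hloss.adapted t ht u).mono (ℱ.le _) le_rfl).aestronglyMeasurable (L * ‖u‖)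
        (Filter.Eventually.of_forall fun ω => ?_)
      have := hloss.lipschitz t ht ω 0 u
      rwa [hloss.zero t ht, sub_zero, sub_zero] at this
  refine ⟨fun u => integrable_finsetSum _ (i1 u), fun a ha y hy => ?_⟩
  have i2 : ∀ t ∈ Finset.range T, Integrable (fun ω =>
      linearizedGap β δ (v t ω) (z t ω) (ghat t ω) (a • y)) P := by
    intro t ht
    rw [Finset.mem_range] at ht
    obtain ⟨m1, m2, _, m4⟩ := hm t ht
    exact Integrable.of_bound (measurable_linearizedGap β δ (m1.mono (ℱ.le _) le_rfl)
      (m2.mono (ℱ.le _) le_rfl) (m4.mono (ℱ.le _) le_rfl) _).aestronglyMeasurable _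
      (Filter.Eventually.of_forall fun ω => abs_linearizedGap_le hβ (hb ω t ht).1.1.le
        (hb ω t ht).1.2 (hb ω t ht).2.1 (hb ω t ht).2.2.2.1 _)
  have hround : ∀ t ∈ Finset.range T, ∫ ω, (loss t ω (w t ω) - loss t ω (a • y)) ∂P ≤
      ∫ ω, linearizedGap β δ (v t ω) (z t ω) (ghat t ω) (a • y) ∂P := by
    intro t htm
    have ht := Finset.mem_range.1 htm
    -- The past is represented by the identity map into `Ω` with the smaller σ-algebra `ℱ t`.
    have hind : @IndepFun Ω Ω (USphere d) mΩ (ℱ t) inferInstance id (s t) P :=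
      (@IndepFun_iff_Indep Ω Ω (USphere d) mΩ (ℱ t) inferInstance id (s t) P).2
        (by rw [MeasurableSpace.comap_id]; exact (hs.indep t ht).symm)
    have h := @integral_loss_sub_linearizedGap_nonpos Ω Ω mΩ (ℱ t) P _ d hd L β δ (1 / δ ^ 3) hL hβ
      hδ hδ1 id (measurable_id'' (ℱ.le t)) (s t) ((hs.measurable t ht).mono (ℱ.le _) le_rfl)
      (hs.law t ht) hind (loss t) (hloss.convex t ht) (hloss.lipschitz t ht) (hloss.smooth t ht)
      (hloss.zero t ht) (hloss.adapted t ht) (v t) (hm t ht).1 (fun ω => (hb ω t ht).1.1)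
      (fun ω => (hb ω t ht).1.2) (z t) (hm t ht).2.1 (fun ω => (hb ω t ht).2.1) (a • y)
    have heq : ∀ ω, loss t ω (w t ω) - loss t ω (a • y)
        - linearizedGap β δ (v t ω) (z t ω) (ghat t ω) (a • y) =
        loss t ω (v t ω • (z t ω + δ • (s t ω : Vec d))) - loss t ω (a • y)
        - linearizedGap β δ (v t ω) (z t ω) (((d : ℝ) / (v t ω * δ) *
          loss t ω (v t ω • (z t ω + δ • (s t ω : Vec d)))) • (s t ω : Vec d)) (a • y) := by
      intro ω
      rw [hrun.estimate t ht ω, hrun.point t ht ω]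
    simp only [id] at h
    simp_rw [← heq] at h
    rw [integral_sub (i1 _ t htm) (i2 t htm)] at h
    linarith
  have hpath : ∀ ω, ∑ t ∈ Finset.range T, linearizedGap β δ (v t ω) (z t ω) (ghat t ω) (a • y) ≤
      Λ * (1 + a * feedbackBound d L β δ * √(T : ℝ))
        + a * (1 / η + η / 4 * (T * (2 * d * L / δ) ^ 2)) + T * (β * δ ^ 2 * a ^ 2) := by
    intro ω
    refine sum_linearizedGap_le (v := fun t => v t ω) (z := fun t => z t ω)
      (g := fun t => ghat t ω) hβ hη hA (fun t ht => hrun.scale t ht ω)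
      (fun t ht => (hb ω t ht).2.2.2.2) (hrun.init ω) (fun t ht => ?_) (fun t ht => ?_)
      (fun t ht => (hb ω t ht).2.2.2.1) ha ha.1.le hy
    · have := hrun.update_mem t ht ω
      rw [one_sub_zero_smul_set] at this
      simpa using this
    · have := hrun.update_min t ht ω
      rwa [one_sub_zero_smul_set] at this
  unfold regret
  rw [integral_finsetSum _ (i1 _)]
  refine (Finset.sum_le_sum hround).trans ?_
  rw [← integral_finsetSum _ i2]
  refine (integral_mono (integrable_finsetSum _ i2) (integrable_const _) hpath).trans ?_
  simp

/-- The scale `0` is not in the half-open segment. With `y = 0` every `a > 0` represents the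
comparator `0`, and all terms except `Λ` vanish as `a → 0`. -/
theorem IsBanditRun.integral_regret_zero_le {d : ℕ} (hd : 1 ≤ d) {Ω : Type*}
    [mΩ : MeasurableSpace Ω] {P : Measure Ω} [IsProbabilityMeasure P]
    {ℱ : Filtration ℕ mΩ} {T : ℕ} {L β δ η Λ : ℝ} {A : ScaleAlg}
    {loss : ℕ → Ω → Vec d → ℝ} {s : ℕ → Ω → USphere d} {v : ℕ → Ω → ℝ} {z w ghat : ℕ → Ω → Vec d}
    (hL : 0 ≤ L) (hβ : 0 ≤ β) (hδ : 0 < δ) (hδ1 : δ ≤ 1) (hη : 0 < η)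
    (hA : ImplementsScale A (Ioc 0 (1 / δ ^ 3)) T (feedbackBound d L β δ) Λ)
    (hloss : IsLossProcess ℱ T L β loss) (hs : IsSampling P ℱ T s)
    (hrun : IsBanditRun T β δ 0 η (Metric.closedBall 0 1) A loss s v z w ghat) :
    ∫ ω, regret T loss w 0 ω ∂P ≤ Λ := by
  have h := (hrun.integral_regret_le hd hL hβ hδ hδ1 hη hA hloss hs).2
  have hcont : Continuous fun a : ℝ => Λ * (1 + a * feedbackBound d L β δ * √(T : ℝ))
      + a * (1 / η + η / 4 * (T * (2 * d * L / δ) ^ 2)) + T * (β * δ ^ 2 * a ^ 2) := by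
    fun_prop
  have hlim := (hcont.tendsto 0).mono_left (nhdsWithin_le_nhds (s := Ioi (0 : ℝ)))
  have hev : ∀ᶠ a in nhdsWithin (0 : ℝ) (Ioi 0), ∫ ω, regret T loss w 0 ω ∂P ≤
      Λ * (1 + a * feedbackBound d L β δ * √(T : ℝ))
        + a * (1 / η + η / 4 * (T * (2 * d * L / δ) ^ 2)) + T * (β * δ ^ 2 * a ^ 2) := by
    have hpos : (0 : ℝ) < 1 / δ ^ 3 := by positivity
    filter_upwards [Ioc_mem_nhdsGT hpos] with a ha
    have := h a ha 0 (by simp)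
    rwa [smul_zero] at this
  have := ge_of_tendsto hlim hev
  simpa using this

theorem regret_le_regret_zero_add {d : ℕ} {Ω : Type*} {T : ℕ} {L : ℝ} {loss : ℕ → Ω → Vec d → ℝ}
    (hlip : ∀ t < T, ∀ ω, IsLip L (loss t ω)) (w : ℕ → Ω → Vec d) (u : Vec d) (ω : Ω) :
    regret T loss w u ω ≤ regret T loss w 0 ω + T * (L * ‖u‖) := by
  have h : ∀ t ∈ Finset.range T, loss t ω (w t ω) - loss t ω u ≤
      (loss t ω (w t ω) - loss t ω 0) + L * ‖u‖ := by
    intro t ht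
    have := (abs_le.1 (hlip t (Finset.mem_range.1 ht) ω 0 u)).1
    rw [sub_zero] at this
    linarith
  refine (Finset.sum_le_sum h).trans ?_
  rw [Finset.sum_add_distrib, Finset.sum_const, Finset.card_range, nsmul_eq_mul]
  rfl

/-! ### Tuning of the parameters and assembly. -/

/-- With `D = d L`, the unclipped value `q` balances `D √T / q` and `q² T`, both equal to `(D
T)^(2/3)`, and satisfies `q³ √T = D`. Clipping at `1` adds the term `D √T` to the first bound and
preserves the others, since `δ ≤ q`. -/
theorem smoothDelta_facts {d T : ℕ} {L δ : ℝ} (hd : 1 ≤ d) (hT : 1 ≤ T) (hL : 1 ≤ L)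
    (hδ : δ = smoothDelta d T L) :
    0 < δ ∧ δ ≤ 1 ∧
    (d : ℝ) * L * √(T : ℝ) / δ ≤ d * L * √(T : ℝ) + ((d : ℝ) * L * T) ^ (2 / 3 : ℝ) ∧
    δ ^ 2 * T ≤ ((d : ℝ) * L * T) ^ (2 / 3 : ℝ) ∧
    √(T : ℝ) ≤ 1 / δ ^ 3 * (d * L) := by
  have hD : (0 : ℝ) < (d : ℝ) * L := by
    have : (0 : ℝ) < d := by exact_mod_cast hd
    positivity
  have hT0 : (0 : ℝ) < T := by exact_mod_cast hT
  set D := (d : ℝ) * L with hDdef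
  obtain ⟨t, htdef⟩ : ∃ t : ℝ, t = T := ⟨_, rfl⟩
  rw [← htdef] at hT0 ⊢
  set q := D ^ (1 / 3 : ℝ) * t ^ (-(1 / 6) : ℝ) with hq
  have hq0 : 0 < q := by positivity
  have hδq : δ = min 1 q := by rw [hδ, smoothDelta, hq, htdef]
  have hδ0 : 0 < δ := by rw [hδq]; exact lt_min one_pos hq0
  have hδ1 : δ ≤ 1 := by rw [hδq]; exact min_le_left _ _
  have hδle : δ ≤ q := by rw [hδq]; exact min_le_right _ _
  have hX : (D * t) ^ (2 / 3 : ℝ) = D ^ (2 / 3 : ℝ) * t ^ (2 / 3 : ℝ) :=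
    Real.mul_rpow hD.le hT0.le
  have hpD : D ^ (1 / 3 : ℝ) * D ^ (2 / 3 : ℝ) = D := by
    rw [← Real.rpow_add hD]; norm_num
  have hpT : t ^ (-(1 / 6) : ℝ) * t ^ (2 / 3 : ℝ) = √t := by
    rw [← Real.rpow_add hT0, Real.sqrt_eq_rpow]; norm_num
  have hq2 : q ^ 2 * t = (D * t) ^ (2 / 3 : ℝ) := by
    have e1 : (D ^ (1 / 3 : ℝ)) ^ 2 = D ^ (2 / 3 : ℝ) := by
      rw [← Real.rpow_natCast, ← Real.rpow_mul hD.le]; norm_num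
    have e2 : (t ^ (-(1 / 6) : ℝ)) ^ 2 * t = t ^ (2 / 3 : ℝ) := by
      rw [← Real.rpow_natCast, ← Real.rpow_mul hT0.le]
      nth_rw 2 [← Real.rpow_one t]
      rw [← Real.rpow_add hT0]; norm_num
    rw [hX, hq, mul_pow, mul_assoc, e1, e2]
  have hqX : q * (D * t) ^ (2 / 3 : ℝ) = D * √t := by
    rw [hX, hq, mul_mul_mul_comm, hpD, hpT]
  have hs0 : 0 < √t := Real.sqrt_pos.2 hT0
  have hq3 : q ^ 3 * √t = D := by
    have h1 : q ^ 3 * t = D * √t := by rw [← hqX, ← hq2]; ring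
    have h2 : (q ^ 3 * √t) * √t = D * √t := by
      rw [mul_assoc, Real.mul_self_sqrt hT0.le, h1]
    exact mul_right_cancel₀ hs0.ne' h2
  refine ⟨hδ0, hδ1, ?_, ?_, ?_⟩
  · rcases min_choice 1 q with h | h
    · rw [hδq, h, div_one]
      have : 0 ≤ (D * t) ^ (2 / 3 : ℝ) := by positivity
      linarith
    · rw [hδq, h, ← hqX, mul_div_cancel_left₀ _ hq0.ne']
      have : 0 ≤ q * (D * t) ^ (2 / 3 : ℝ) := by positivity
      linarith
  · rw [← hq2]
    gcongr
  · rw [one_div_mul_eq_div, le_div_iff₀ (by positivity), ← hq3, mul_comm]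
    gcongr

theorem learningRate_facts {d T : ℕ} {L δ : ℝ} (hd : 1 ≤ d) (hT : 1 ≤ T) (hL : 1 ≤ L)
    (hδ : 0 < δ) :
    0 < learningRate d T L δ ∧
    1 / learningRate d T L δ + learningRate d T L δ / 4 * (T * (2 * d * L / δ) ^ 2) =
      5 / 2 * (d * L * √(T : ℝ) / δ) := by
  have hd0 : (0 : ℝ) < d := by exact_mod_cast hd
  have hL0 : 0 < L := by linarith
  have hT0 : (0 : ℝ) < T := by exact_mod_cast hT
  have hs0 : 0 < √(T : ℝ) := Real.sqrt_pos.2 hT0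
  have hs2 : √(T : ℝ) ^ 2 = T := Real.sq_sqrt hT0.le
  have heq : learningRate d T L δ = δ / (2 * (d * L) * √(T : ℝ)) := by
    rw [learningRate, Real.sqrt_eq_iff_mul_self_eq (by positivity) (by positivity)]
    field_simp
    rw [hs2]
    norm_num
  rw [heq]
  refine ⟨by positivity, ?_⟩
  field_simp
  rw [hs2]
  ring

/-- Here `n` and `N` stand for the two norms of `u`, `s` for `√T`, `D` for `d L`, `B` for `d L²` and
`Q` for `(d L T)^(2/3)`. Everything linear in `n` is controlled by `n β D s / δ ≤ X + Y`; the
quadratic term is controlled by `X` alone. -/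
theorem final_bound {p c G s D β B δ n N X Y T Q : ℝ} (hp : 1 ≤ p) (hs : 0 ≤ s) (hT : 0 ≤ T)
    (hD : 1 ≤ D) (hβ : 1 ≤ β) (hδ : 0 < δ) (hn : 0 ≤ n) (hnN : n ≤ N) (hG : G = (2 * D + 2 * β) / δ)
    (hQ : 0 ≤ Q) (h1 : D * s / δ ≤ D * s + Q) (h2 : δ ^ 2 * T ≤ Q)
    (hX : X = max (N ^ 2) N * β * Q) (hB : D ≤ B) (hY : Y = max (n ^ 2) N * B * β * s) :
    c * p * (1 + n * G * s) + n * (5 / 2 * (D * s / δ)) + T * (β * δ ^ 2 * n ^ 2) ≤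
      4 * (|c| + 1) * p * (1 + X + Y) := by
  have hβ0 : 0 ≤ β := by linarith
  have hD0 : 0 ≤ D := by linarith
  have hN : 0 ≤ N := hn.trans hnN
  have hXn : n * β * Q ≤ X := by
    rw [hX]
    gcongr
    exact hnN.trans (le_max_right _ _)
  have hYn : n * (B * β * s) ≤ Y := by
    have : 0 ≤ B * β * s := mul_nonneg (mul_nonneg (hD0.trans hB) hβ0) hs
    have e : Y = max (n ^ 2) N * (B * β * s) := by rw [hY]; ring
    rw [e]
    exact mul_le_mul_of_nonneg_right (hnN.trans (le_max_right _ _)) this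
  have hX0 : 0 ≤ X := le_trans (by positivity) hXn
  have hbase : n * (β * (D * s / δ)) ≤ X + Y := by
    have e1 : n * (β * (D * s / δ)) ≤ n * (β * (D * s + Q)) := by gcongr
    have e2 : n * (D * β * s) ≤ n * (B * β * s) := by gcongr
    linarith
  have hXY : 0 ≤ X + Y := le_trans (by positivity) hbase
  have hmain : n * G * s ≤ 4 * (X + Y) := by
    -- Both factors are at least `1`, so each is at most the product.
    have e1 : D + β ≤ 2 * (β * D) := by nlinarith
    have e2 : n * G * s = 2 * (n * s / δ) * (D + β) := by rw [hG]; ring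
    have e3 : 2 * (n * s / δ) * (D + β) ≤ 2 * (n * s / δ) * (2 * (β * D)) := by gcongr
    have e4 : 2 * (n * s / δ) * (2 * (β * D)) = 4 * (n * (β * (D * s / δ))) := by ring
    linarith
  have hG0 : 0 ≤ n * G * s := by rw [hG]; positivity
  have hmid : n * (5 / 2 * (D * s / δ)) ≤ 5 / 2 * (X + Y) := by
    have : n * (D * s / δ) ≤ n * (β * (D * s / δ)) := by
      gcongr
      exact le_mul_of_one_le_left (by positivity) hβ
    linarith
  have hlast : T * (β * δ ^ 2 * n ^ 2) ≤ X := by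
    have e1 : T * (β * δ ^ 2 * n ^ 2) = n ^ 2 * β * (δ ^ 2 * T) := by ring
    rw [e1, hX]
    have : n ^ 2 ≤ max (N ^ 2) N := (pow_le_pow_left₀ hn hnN 2).trans (le_max_left _ _)
    gcongr
  have hYnn : 0 ≤ Y := le_trans (mul_nonneg hn (mul_nonneg (mul_nonneg (hD0.trans hB) hβ0) hs)) hYn
  have hfirst : c * p * (1 + n * G * s) ≤ |c| * p * (1 + 4 * (X + Y)) := by
    have e1 : c * p * (1 + n * G * s) ≤ |c| * p * (1 + n * G * s) := by
      gcongr
      exact le_abs_self c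
    refine e1.trans ?_
    gcongr
  have hc : 0 ≤ |c| := abs_nonneg c
  have h3 : 4 * (1 + X + Y) ≤ 4 * p * (1 + X + Y) := by nlinarith
  have h4 : 0 ≤ |c| * p := by positivity
  nlinarith

theorem mainTheorem3 (C₀ : ℝ) (k : ℕ) :
    ∃ C : ℝ, ∀ (d T : ℕ) (L β M : ℝ), 1 ≤ d → 1 ≤ T → 1 ≤ L → 1 ≤ β → 1 ≤ M →
      ∀ δ : ℝ, δ = smoothDelta d T L →
      ∀ A : ScaleAlg,
        ImplementsScale A (Set.Ioc 0 (1 / δ ^ 3)) T (feedbackBound d L β δ) (polylog C₀ k T M) →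
      ∀ (Ω : Type*) [mΩ : MeasurableSpace Ω] (P : MeasureTheory.Measure Ω)
        [MeasureTheory.IsProbabilityMeasure P] (ℱ : MeasureTheory.Filtration ℕ mΩ)
        (loss : ℕ → Ω → Vec d → ℝ) (s : ℕ → Ω → USphere d)
        (v : ℕ → Ω → ℝ) (z w ghat : ℕ → Ω → Vec d),
        IsLossProcess ℱ T L β loss →
        IsSampling P ℱ T s →
        IsBanditRun T β δ 0 (learningRate d T L δ) (Metric.closedBall 0 1) A loss s v z w ghat →
      ∀ N : Seminorm ℝ (Vec d), (∀ x, ‖x‖ ≤ N x) →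
      ∀ u : Vec d,
        MeasureTheory.Integrable (regret T loss w u) P ∧
        ∫ ω, regret T loss w u ω ∂P ≤
          polylog C k T M *
            (1 + max (N u ^ 2) (N u) * β * ((d : ℝ) * L * (T : ℝ)) ^ (2 / 3 : ℝ)
              + max (‖u‖ ^ 2) (N u) * (d : ℝ) * L ^ 2 * β * √(T : ℝ)) := by
  refine ⟨4 * (|C₀| + 1), ?_⟩
  intro d T L β M hd hT hL hβ hM δ hδ A hA Ω mΩ P _ ℱ loss s v z w ghat hloss hs hrun N hN u
  have hL0 : 0 ≤ L := by linarith
  have hβ0 : 0 ≤ β := by linarith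
  have hd1 : (1 : ℝ) ≤ d := by exact_mod_cast hd
  have hT1 : (1 : ℝ) ≤ T := by exact_mod_cast hT
  obtain ⟨hδ0, hδ1, hdiv, hsq, hcube⟩ := smoothDelta_facts hd hT hL hδ
  obtain ⟨hη, hηeq⟩ := learningRate_facts hd hT hL hδ0
  obtain ⟨hint, hreg⟩ := hrun.integral_regret_le hd hL0 hβ0 hδ0 hδ1 hη hA hloss hs
  refine ⟨hint u, ?_⟩
  have hDL : (1 : ℝ) ≤ d * L := one_le_mul_of_one_le_of_one_le hd1 hL
  have hp : 1 ≤ (1 + Real.log (T : ℝ) + Real.log M) ^ k := by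
    refine one_le_pow₀ ?_
    linarith [Real.log_nonneg hT1, Real.log_nonneg hM]
  have hQ0 : 0 ≤ ((d : ℝ) * L * T) ^ (2 / 3 : ℝ) := by positivity
  have hB : (d : ℝ) * L ≤ d * L ^ 2 := by nlinarith
  have hfinal := final_bound (c := C₀) (G := feedbackBound d L β δ) (n := ‖u‖) (N := N u) hp
    (Real.sqrt_nonneg T) (T.cast_nonneg) hDL hβ hδ0 (norm_nonneg u) (hN u)
    (by rw [feedbackBound, mul_assoc]) hQ0 hdiv hsq rfl hB (by rw [← mul_assoc])
  change _ ≤ polylog (4 * (|C₀| + 1)) k T M * _ at hfinal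
  have hzero := hrun.integral_regret_zero_le hd hL0 hβ0 hδ0 hδ1 hη hA hloss hs
  rcases (norm_nonneg u).eq_or_lt with h0 | hpos
  · have hu : u = 0 := norm_eq_zero.1 h0.symm
    refine le_trans ?_ hfinal
    rw [← h0, hu]
    simpa [polylog] using hzero
  rcases le_or_gt ‖u‖ (1 / δ ^ 3) with hle | hgt
  · have h := hreg ‖u‖ ⟨hpos, hle⟩ (‖u‖⁻¹ • u) (by
      rw [norm_smul, norm_inv, norm_norm, inv_mul_cancel₀ hpos.ne'])
    rw [smul_inv_smul₀ hpos.ne', hηeq] at h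
    exact h.trans hfinal
  · have h1 := integral_mono (hint u) ((hint 0).add (integrable_const _))
      (regret_le_regret_zero_add hloss.lipschitz w u)
    simp only [Pi.add_apply] at h1
    rw [integral_add (hint 0) (integrable_const _)] at h1
    simp only [integral_const, probReal_univ, one_smul] at h1
    -- For comparators beyond the segment, one factor `√T` of the trivial cost `T L ‖u‖` is traded
    -- for `‖u‖ d L`. This is the source of the term with `‖u‖ ^ 2`.
    have hs1 : √(T : ℝ) ≤ ‖u‖ * (d * L) := hcube.trans (by gcongr)
    have h2 : (T : ℝ) * (L * ‖u‖) ≤ ‖u‖ ^ 2 * (d * L ^ 2) * √(T : ℝ) := by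
      calc (T : ℝ) * (L * ‖u‖) = √(T : ℝ) * (L * ‖u‖) * √(T : ℝ) := by
            nth_rw 1 [← Real.mul_self_sqrt (Nat.cast_nonneg T)]
            ring
        _ ≤ ‖u‖ * (d * L) * (L * ‖u‖) * √(T : ℝ) := by gcongr
        _ = _ := by ring
    have h3 : ‖u‖ ^ 2 * (d * L ^ 2) * √(T : ℝ) ≤
        max (‖u‖ ^ 2) (N u) * (d : ℝ) * L ^ 2 * β * √(T : ℝ) := by
      rw [mul_assoc (max _ _)]
      refine mul_le_mul_of_nonneg_right ?_ (Real.sqrt_nonneg _)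
      refine (mul_le_mul_of_nonneg_right (le_max_left _ (N u)) (by positivity)).trans ?_
      exact le_mul_of_one_le_right (by positivity) hβ
    have hX0 : 0 ≤ max (N u ^ 2) (N u) * β * ((d : ℝ) * L * (T : ℝ)) ^ (2 / 3 : ℝ) := by positivity
    have hY0 : 0 ≤ max (‖u‖ ^ 2) (N u) * (d : ℝ) * L ^ 2 * β * √(T : ℝ) := by positivity
    simp only [polylog] at hzero ⊢
    set X := max (N u ^ 2) (N u) * β * ((d : ℝ) * L * (T : ℝ)) ^ (2 / 3 : ℝ)
    set Y := max (‖u‖ ^ 2) (N u) * (d : ℝ) * L ^ 2 * β * √(T : ℝ)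
    set p := (1 + Real.log (T : ℝ) + Real.log M) ^ k
    have h4 : C₀ * p ≤ |C₀| * p := by
      gcongr
      exact le_abs_self C₀
    have h5 : 0 ≤ |C₀| * p := by positivity
    have h6 : (|C₀| * p + p) * 1 ≤ (|C₀| * p + p) * (1 + X + Y) := by gcongr; linarith
    have h7 : 1 * Y ≤ p * Y := by gcongr
    have h8 : 0 ≤ p * X := by positivity
    nlinarith [mul_nonneg h5 hX0, mul_nonneg h5 hY0]
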